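/- Let $u$ be a Lévy density on $(0,\infty)$, i.e. $u\ge 0$ and $\int_0^\infty \min(1,x)\,u(x)\,dx<\infty$, let $$\kappa(\theta)=\int_0^\infty (e^{-\theta x}-1)\,u(x)\,dx \qquad(\Re\theta\ge 0)$$ be its cumulant function, and let $(X_t)_{t\ge 0}$ be the driftless pure-jump subordinator with Lévy density $u$, so that $E\,e^{-\theta X_t}=e^{t\kappa(\theta)}$ for $\Re\theta\ge0$. Suppose $$a>0,\quad 0<\alpha<1,\quad \beta>-1,\quad \gamma>0,\quad 0<\psi<\pi/2,$$ that $u$ extends to an analytic function in a domain containing the closed sector $W=\{z\in\mathbb C: z\ne0,\ |\arg z|\le\psi\}$, and that $$u(z)=a z^{-1-\alpha}+O(|z|^{\beta})\quad (z\to0 \text{ in } W),\qquad u(z)=O(e^{\gamma\Re z})\quad (z\to\infty\text{ in }W).$$ Then $\kappa$ admits an analytic continuation, again denoted $\kappa$, from $\{\Re\theta>\gamma\}$ to the open cone $\{\theta\ne\gamma:\ |\arg(\theta-\gamma)|<\tfrac{\pi}{2}+\psi\}$. Moreover $u(x)-a x^{-1-\alpha}$ is integrable on $(0,\infty)$ and,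 for every $c>\gamma$, $$\kappa(\theta)-a\,\Gamma(-\alpha)\,\theta^{\alpha}+\int_0^\infty\bigl(u(x)-a x^{-1-\alpha}\bigr)\,dx\ \longrightarrow\ 0$$ uniformly as $\theta\to\infty$ in the closed cone $\{|\arg(\theta-c)|\le\tfrac{\pi}{2}+\psi\}$ (principal branch of $\theta^\alpha$). Furthermore, for every $t>0$ the law of $X_t$ is concentrated on $(0,\infty)$ and has a density $p(x;t)$ there that is continuous in $x>0$; for every $x>0$, the function $t\mapsto p(x;t)$ extends to an entire function of $t\in\mathbb C$, and for all $t\in\mathbb C$ $$p(x;t)=\sum_{n\ge1}u_n(x)\,\frac{t^n}{n!},\qquad u_n(x)=\frac{1}{2\pi i}\int_{\mathcal C}\kappa(\theta)^n e^{\theta x}\,d\theta\quad(n\ge1),$$ where, for an arbitrary fixed $c>\gamma$, $\mathcal C$ is the contour $|\arg(\theta-c)|=\tfrac{\pi}{2}+\psi$, run from $\infty e^{-i(\pi/2+\psi)}$ through $c$ to $\infty e^{i(\pi/2+\psi)}$ (so that $\theta=0$ lies on its left), and the integrals converge absolutely. -/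

import Mathlib

open MeasureTheory ProbabilityTheory Set Filter Topology
open scoped NNReal

noncomputable section

/-- `u` (only its values on `(0, ∞)` matter) is the density of a Lévy measure of a subordinator:
it is nonnegative on `(0, ∞)` and `∫₀^∞ min(1, x) u(x) dx < ∞`. -/
def IsLevyDensity (u : ℝ → ℝ) : Prop :=
  (∀ x, 0 < x → 0 ≤ u x) ∧ IntegrableOn (fun x => min 1 x * u x) (Ioi 0)

/-- The cumulant function `κ(θ) = ∫₀^∞ (e^{-θx} - 1) u(x) dx`; for a Lévy density the integral
converges absolutely when `Re θ ≥ 0`. -/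
def cumulant (u : ℝ → ℝ) (θ : ℂ) : ℂ :=
  ∫ x in Ioi (0 : ℝ), (Complex.exp (-θ * x) - 1) * (u x : ℂ)

/-- `X` is a (real-valued) subordinator: a process started at `0` with independent and stationary
increments and with nondecreasing right-continuous paths. -/
structure IsSubordinator {Ω : Type*} [MeasurableSpace Ω] (X : ℝ≥0 → Ω → ℝ) (P : Measure Ω) :
    Prop where
  measurable : ∀ t, Measurable (X t)
  zero : ∀ᵐ ω ∂P, X 0 ω = 0
  indep : HasIndepIncrements X P
  stationary : ∀ s t, IdentDistrib (fun ω => X (s + t) ω - X s ω) (X t) P P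
  paths : ∀ᵐ ω ∂P, Monotone (fun t => X t ω) ∧
    ∀ t, ContinuousWithinAt (fun s => X s ω) (Ici t) t

/-- `X` is the driftless (pure jump) subordinator whose Lévy measure has density `u`,
as specified by the Lévy–Khintchine formula `E e^{-θ X_t} = e^{t κ(θ)}`, `Re θ ≥ 0`. -/
structure IsSubordinatorWithLevyDensity {Ω : Type*} [MeasurableSpace Ω]
    (X : ℝ≥0 → Ω → ℝ) (P : Measure Ω) (u : ℝ → ℝ) : Prop where
  subordinator : IsSubordinator X P
  laplace : ∀ (t : ℝ≥0) (θ : ℂ), 0 ≤ θ.re →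
    ∫ ω, Complex.exp (-θ * (X t ω : ℂ)) ∂P = Complex.exp (((t : ℝ) : ℂ) * cumulant u θ)

/-- `μ` is concentrated on `(0, ∞)` and `f` is its (unique) probability density that is
continuous on `(0, ∞)`. -/
def HasContinuousDensity (μ : Measure ℝ) (f : ℝ → ℝ) : Prop :=
  ContinuousOn f (Ioi 0) ∧ (∀ x, 0 < x → 0 ≤ f x) ∧
    μ = (volume.restrict (Ioi 0)).withDensity (fun x => ENNReal.ofReal (f x))

/-- The closed sector `{z ≠ 0 : |arg z| ≤ ψ}`. -/
def sectorW (ψ : ℝ) : Set ℂ := {z | z ≠ 0 ∧ |z.arg| ≤ ψ}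

/-- The open cone `{θ ≠ γ : |arg (θ - γ)| < φ}` with apex `γ`. -/
def openCone (γ φ : ℝ) : Set ℂ := {θ | θ ≠ (γ : ℂ) ∧ |(θ - γ).arg| < φ}

/-- The closed cone `{θ : |arg (θ - c)| ≤ φ}` with apex `c` (included, as `arg 0 = 0`). -/
def closedCone (c φ : ℝ) : Set ℂ := {θ | |(θ - c).arg| ≤ φ}

/-- The point at distance `r` from the apex `c` on the ray of direction `e^{iφ}`. -/
def rayPoint (c φ r : ℝ) : ℂ := c + r * Complex.exp (φ * Complex.I)

/-- Absolute integrability of `f` along the contour `|arg (θ - c)| = φ`. -/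
def ContourIntegrable (c φ : ℝ) (f : ℂ → ℂ) : Prop :=
  IntegrableOn (fun r : ℝ => f (rayPoint c φ r)) (Ioi 0) ∧
    IntegrableOn (fun r : ℝ => f (rayPoint c (-φ) r)) (Ioi 0)

/-- The integral of `f` along the contour `|arg (θ - c)| = φ`, run from `∞ e^{-iφ}` through the
apex `c` to `∞ e^{iφ}` (so that points to the left of `c` on the real line lie on its left). -/
def contourIntegral (c φ : ℝ) (f : ℂ → ℂ) : ℂ :=
  (∫ r in Ioi (0 : ℝ), f (rayPoint c φ r) * Complex.exp (φ * Complex.I)) -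
    ∫ r in Ioi (0 : ℝ), f (rayPoint c (-φ) r) * Complex.exp (-φ * Complex.I)

/-- The coefficient `(2πi)⁻¹ ∫_C K(θ)ⁿ e^{θx} dθ`, with `C` the contour `|arg (θ - c)| = φ`. -/
def contourCoeff (K : ℂ → ℂ) (c φ : ℝ) (n : ℕ) (x : ℝ) : ℂ :=
  (2 * Real.pi * Complex.I)⁻¹ * contourIntegral c φ (fun θ => K θ ^ n * Complex.exp (θ * x))

end

/-! Write `u = a x^(-1-α) + v`. The stable part has the explicit cumulant `a Γ(-α) θ^α`. The
remainder `v` is integrable on `(0, ∞)`, so it contributes its Laplace transform minus the constant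
`∫ v`. In the sector, `v` extends to an analytic `g` with `‖g z‖ ≤ M (1 + ‖z‖^β) e^(γ Re z)`, so the
ray of integration may be rotated to `arg z = ∓ψ`. The rotated transforms are holomorphic on the
half-planes `Re ((θ - γ) e^(∓iψ)) > 0`, whose union is the open cone, and they agree where they
overlap near the real axis. A Riemann–Lebesgue lemma that is uniform on closed half-planes makes
them vanish at infinity. This gives the continuation `K` and its asymptotics
(`exists_cumulant_continuation`).

Consequently `K θ = O(1 + |θ|^α)` with `α < 1`, while `e^(θx)` decays exponentially in `|θ|` on the
contour, whose rays point into the left half-plane. Hence `e^(θx)` beats `e^(|t| |K θ|)` for every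
complex `t` (`exists_exp_norm_mul_norm_le`), and the exponential series can be integrated termwise.
Its sum is entire in `t` and equals `(2πi)⁻¹ ∫ (e^(tK) - 1) e^(θx) dθ`. The `-1` may be dropped,
because `e^(θx)` alone integrates to zero over the contour.

For real `t > 0`, the sign `Γ(-α) < 0` makes `e^(tK)` decay like `exp (-b |θ|^α)` near the vertical
direction, where `e^(θx)` no longer helps. The contour can therefore be opened to the line `Re θ =
c` (`integrable_and_contourIntegral_eq_integral_line`), and the result is the Bromwich integral of
`E e^(-θ X_t)`. Fourier inversion of the law tilted by `e^(-cx)` identifies it with the density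
(`hasContinuousDensity_of_laplace`). -/

/-! ### Rotation of rays of integration -/

/-- Substitution `r = exp x` in an integral over `(0, ∞)`. -/
theorem integral_exp_smul_comp_exp {E : Type*} [NormedAddCommGroup E] [NormedSpace ℝ E]
    (g : ℝ → E) : ∫ x : ℝ, Real.exp x • g (Real.exp x) = ∫ r in Ioi (0 : ℝ), g r := by
  have h := integral_image_eq_integral_abs_deriv_smul (MeasurableSet.univ (α := ℝ))
    (fun x _ => (Real.hasDerivAt_exp x).hasDerivWithinAt) Real.exp_injective.injOn g
  rw [image_univ, Real.range_exp] at h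
  simpa [abs_of_pos (Real.exp_pos _)] using h.symm

theorem integrable_exp_smul_comp_exp {E : Type*} [NormedAddCommGroup E] [NormedSpace ℝ E]
    {g : ℝ → E} (hg : IntegrableOn g (Ioi 0)) :
    Integrable (fun x : ℝ => Real.exp x • g (Real.exp x)) := by
  have h := integrableOn_image_iff_integrableOn_abs_deriv_smul (MeasurableSet.univ (α := ℝ))
    (fun x _ => (Real.hasDerivAt_exp x).hasDerivWithinAt) Real.exp_injective.injOn g
  rw [image_univ, Real.range_exp] at h
  simpa [abs_of_pos (Real.exp_pos _)] using h.1 hg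

/-- **Rotation of a ray of integration.** If `f` is holomorphic in the closed sector between the
directions `ω₁` and `ω₂` and `z f z` tends to zero at the apex and at infinity, then the integrals
of `f` along the two bounding rays agree. -/
theorem integral_ray_eq_integral_ray {f : ℂ → ℂ} {ω₁ ω₂ : ℝ} (hω : ω₁ ≤ ω₂)
    (hf : ∀ r : ℝ, 0 < r → ∀ ω ∈ Icc ω₁ ω₂,
      DifferentiableAt ℂ f (r * Complex.exp (ω * Complex.I)))
    {B : ℝ → ℝ}
    (hB : ∀ r : ℝ, 0 < r → ∀ ω ∈ Icc ω₁ ω₂, r * ‖f (r * Complex.exp (ω * Complex.I))‖ ≤ B r)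
    (hB0 : Tendsto B (𝓝[>] 0) (𝓝 0)) (hB1 : Tendsto B atTop (𝓝 0))
    (hi₁ : IntegrableOn (fun r : ℝ => f (r * Complex.exp (ω₁ * Complex.I))) (Ioi 0))
    (hi₂ : IntegrableOn (fun r : ℝ => f (r * Complex.exp (ω₂ * Complex.I))) (Ioi 0)) :
    (∫ r in Ioi (0 : ℝ), f (r * Complex.exp (ω₁ * Complex.I)) * Complex.exp (ω₁ * Complex.I)) =
      ∫ r in Ioi (0 : ℝ), f (r * Complex.exp (ω₂ * Complex.I)) * Complex.exp (ω₂ * Complex.I) := by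
  -- In the logarithmic coordinate `z = e^w` the sector becomes a horizontal strip and the rays
  -- become horizontal lines, so Cauchy's theorem on rectangles suffices. The vertical sides carry
  -- `z f z`, which `B` controls.
  set F : ℂ → ℂ := fun w => f (Complex.exp w) * Complex.exp w with hF
  have hexp : ∀ x ω : ℝ, Complex.exp (x + ω * Complex.I)
      = (Real.exp x : ℝ) * Complex.exp (ω * Complex.I) := fun x ω => by
    rw [Complex.exp_add, Complex.ofReal_exp]
  have hFx : ∀ ω : ℝ, (fun x : ℝ => F (x + ω * Complex.I)) = fun x => Real.exp x •
      (fun r : ℝ => f (r * Complex.exp (ω * Complex.I)) * Complex.exp (ω * Complex.I))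
        (Real.exp x) := fun ω => by
    funext x
    simp only [hF, hexp, Complex.real_smul]
    ring
  have hint : ∀ ω : ℝ, IntegrableOn (fun r : ℝ => f (r * Complex.exp (ω * Complex.I))) (Ioi 0) →
      Integrable (fun x : ℝ => F (x + ω * Complex.I)) := fun ω h => by
    rw [hFx]
    exact integrable_exp_smul_comp_exp (h.mul_const _)
  have hval : ∀ ω : ℝ, ∫ x : ℝ, F (x + ω * Complex.I) = ∫ r in Ioi (0 : ℝ),
      f (r * Complex.exp (ω * Complex.I)) * Complex.exp (ω * Complex.I) := fun ω => by
    rw [hFx, integral_exp_smul_comp_exp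
      (fun r : ℝ => f (r * Complex.exp (ω * Complex.I)) * Complex.exp (ω * Complex.I))]
  have hlim : ∀ ω : ℝ, IntegrableOn (fun r : ℝ => f (r * Complex.exp (ω * Complex.I))) (Ioi 0) →
      Tendsto (fun T : ℝ => ∫ x in (-T)..T, F (x + ω * Complex.I)) atTop
        (𝓝 (∫ r in Ioi (0 : ℝ),
          f (r * Complex.exp (ω * Complex.I)) * Complex.exp (ω * Complex.I))) := fun ω h => by
    rw [← hval]
    exact intervalIntegral_tendsto_integral (hint ω h) tendsto_neg_atTop_atBot tendsto_id
  have hnorm : ∀ x : ℝ, ‖∫ y in ω₁..ω₂, F (x + y * Complex.I)‖ ≤ B (Real.exp x) * |ω₂ - ω₁| := by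
    intro x
    refine intervalIntegral.norm_integral_le_of_norm_le_const fun y hy => ?_
    rw [uIoc_of_le hω] at hy
    have := hB (Real.exp x) (Real.exp_pos x) y ⟨hy.1.le, hy.2⟩
    simp only [hF, hexp, norm_mul, Complex.norm_real, Complex.norm_exp_ofReal_mul_I, mul_one,
      Real.norm_eq_abs, Real.abs_exp]
    linarith
  have hvert : ∀ l : Filter ℝ, ∀ x : ℝ → ℝ, Tendsto (fun T => B (Real.exp (x T))) l (𝓝 0) →
      Tendsto (fun T => ∫ y in ω₁..ω₂, F ((x T : ℝ) + y * Complex.I)) l (𝓝 0) := by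
    intro l x hx
    refine squeeze_zero_norm (fun T => hnorm (x T)) ?_
    simpa using hx.mul_const |ω₂ - ω₁|
  have hr := hvert atTop (fun T => T) (hB1.comp Real.tendsto_exp_atTop)
  have hl := hvert atTop (fun T => -T) (hB0.comp (tendsto_nhdsWithin_iff.2
    ⟨Real.tendsto_exp_atBot.comp tendsto_neg_atTop_atBot,
      Eventually.of_forall fun _ => Real.exp_pos _⟩))
  have hcauchy : ∀ T : ℝ, (∫ x in (-T)..T, F (x + ω₁ * Complex.I)) -
      (∫ x in (-T)..T, F (x + ω₂ * Complex.I)) +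
      Complex.I • (∫ y in ω₁..ω₂, F ((T : ℝ) + y * Complex.I)) -
      Complex.I • (∫ y in ω₁..ω₂, F (((-T : ℝ) : ℂ) + y * Complex.I)) = 0 := by
    intro T
    have := Complex.integral_boundary_rect_eq_zero_of_differentiableOn F ⟨-T, ω₁⟩ ⟨T, ω₂⟩ ?_
    · simpa using this
    · intro w hw
      rw [Complex.mem_reProdIm] at hw
      have h2 : w.im ∈ Icc ω₁ ω₂ := by simpa [uIcc_of_le hω] using hw.2
      have hd := hf (Real.exp w.re) (Real.exp_pos _) w.im h2
      rw [← hexp, Complex.re_add_im] at hd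
      exact ((hd.comp w Complex.differentiableAt_exp).mul
        Complex.differentiableAt_exp).differentiableWithinAt
  have := ((((hlim ω₁ hi₁).sub (hlim ω₂ hi₂)).add (hr.const_smul Complex.I)).sub
    (hl.const_smul Complex.I))
  simp only [hcauchy, smul_zero, add_zero, sub_zero] at this
  exact sub_eq_zero.1 (tendsto_nhds_unique tendsto_const_nhds this).symm

/-! ### Riemann–Lebesgue and holomorphy for Laplace transforms -/

/-- The `L¹` norm of `h - h (· - w)` tends to zero with `w`. -/
theorem tendsto_integral_norm_sub_translate {h : ℝ → ℂ} (hh : Integrable h) :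
    Tendsto (fun w : ℝ => ∫ x, ‖h (x - w) - h x‖) (𝓝 0) (𝓝 0) := by
  set f : Lp ℂ 1 (volume : Measure ℝ) := hh.toL1 h with hf
  have hmp : ∀ w : ℝ, MeasurePreserving (fun x : ℝ => x - w) volume volume :=
    fun w => measurePreserving_sub_right volume w
  let G : ℝ → C(ℝ, ℝ) := fun w => ⟨fun x => x - w, by fun_prop⟩
  have hG : Continuous G :=
    ContinuousMap.continuous_of_continuous_uncurry _
      (show Continuous fun p : ℝ × ℝ => p.2 - p.1 by fun_prop)
  -- Translations are a continuous family of measure preserving maps, so composing a fixed element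
  -- of `L¹` with them is continuous in the parameter.
  have hcont : Continuous fun w => Lp.compMeasurePreserving (G w) (hmp w) f :=
    (continuous_const (y := f)).compMeasurePreservingLp hG hmp (by simp)
  have h0 : Tendsto (fun w => ‖Lp.compMeasurePreserving (G w) (hmp w) f
      - Lp.compMeasurePreserving (G 0) (hmp 0) f‖) (𝓝 0) (𝓝 0) := by
    have := (hcont.tendsto 0).sub_const (Lp.compMeasurePreserving (G 0) (hmp 0) f)
    simpa using this.norm
  refine h0.congr fun w => ?_
  rw [L1.norm_eq_integral_norm]
  refine integral_congr_ae ?_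
  have e1 : ∀ w, (Lp.compMeasurePreserving (G w) (hmp w) f : ℝ → ℂ) =ᵐ[volume]
      fun x => h (x - w) := fun w => by
    refine (Lp.coeFn_compMeasurePreserving f (hmp w)).trans ?_
    exact (hmp w).quasiMeasurePreserving.ae_eq_comp hh.coeFn_toL1
  filter_upwards [Lp.coeFn_sub (Lp.compMeasurePreserving (G w) (hmp w) f)
    (Lp.compMeasurePreserving (G 0) (hmp 0) f), e1 w, e1 0] with x h1 h2 h3
  rw [h1, Pi.sub_apply, h2, h3, sub_zero]

/-- The Riemann–Lebesgue lemma for Laplace transforms, uniformly in the closed right half-plane. -/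
theorem tendsto_laplace_cobounded_halfPlane {h : ℝ → ℂ} (hh : IntegrableOn h (Ioi 0)) :
    Tendsto (fun s : ℂ => ∫ r in Ioi (0 : ℝ), h r * Complex.exp (-(s * r)))
      (Bornology.cobounded ℂ ⊓ 𝓟 {s | 0 ≤ s.re}) (𝓝 0) := by
  set k : ℝ → ℂ := (Ioi (0 : ℝ)).indicator h with hk
  have hki : Integrable k := (integrable_indicator_iff measurableSet_Ioi).2 hh
  have hk0 : ∀ r ≤ 0, k r = 0 := fun r hr => indicator_of_notMem (by simpa using hr) _
  have hH : ∀ s : ℂ, ∫ r in Ioi (0 : ℝ), h r * Complex.exp (-(s * r)) =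
      ∫ r : ℝ, k r * Complex.exp (-(s * r)) := fun s => by
    rw [← integral_indicator measurableSet_Ioi]
    congr 1 with r
    simp only [hk, indicator_mul_left]
  have hnorm : ∀ (s : ℂ), 0 ≤ s.re → ∀ r : ℝ, 0 ≤ r → ‖Complex.exp (-(s * r))‖ ≤ 1 := by
    intro s hs r hr
    rw [Complex.norm_exp]
    simpa using mul_nonneg hs hr
  have hint : ∀ s : ℂ, 0 ≤ s.re → Integrable (fun r : ℝ => k r * Complex.exp (-(s * r))) := by
    intro s hs
    refine hki.mono (hki.aestronglyMeasurable.mul (by fun_prop)) (Eventually.of_forall fun r => ?_)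
    rcases le_or_gt r 0 with hr | hr
    · simp [hk0 r hr]
    · rw [norm_mul]
      exact mul_le_of_le_one_right (norm_nonneg _) (hnorm s hs r hr.le)
  -- Translating `k` by `w` multiplies its transform by `e^(-sw)`, so `(e^(-sw) - 1) H` is the
  -- transform of a difference that is small in `L¹`. The half-period shift of the classical proof
  -- suits only imaginary `s`. Choosing `|sw| = 1/2` keeps the factor away from zero for every `s`,
  -- and `w > 0` keeps the support in `[0, ∞)`, where `|e^(-sr)| ≤ 1`.
  have hbound : ∀ s : ℂ, 0 ≤ s.re → s ≠ 0 →
      ‖∫ r in Ioi (0 : ℝ), h r * Complex.exp (-(s * r))‖ ≤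
        4 * ∫ r, ‖k (r - (2 * ‖s‖)⁻¹) - k r‖ := by
    intro s hs hs0
    have hsn : 0 < ‖s‖ := norm_pos_iff.2 hs0
    set w : ℝ := (2 * ‖s‖)⁻¹ with hw
    have hw0 : 0 < w := by positivity
    rw [hH]
    set H := ∫ r : ℝ, k r * Complex.exp (-(s * r)) with hHdef
    have hshift : ∫ r : ℝ, k (r - w) * Complex.exp (-(s * r)) = Complex.exp (-(s * w)) * H := by
      rw [hHdef, ← integral_const_mul,
        ← integral_sub_right_eq_self (fun r : ℝ => Complex.exp (-(s * w)) *
          (k r * Complex.exp (-(s * r)))) w]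
      congr 1 with r
      have : Complex.exp (-(s * r)) = Complex.exp (-(s * w)) *
          Complex.exp (-(s * ((r - w : ℝ) : ℂ))) := by
        rw [← Complex.exp_add]; congr 1; push_cast; ring
      rw [this]; ring
    have hsi : Integrable (fun r : ℝ => k (r - w) * Complex.exp (-(s * r))) := by
      have := ((hint s hs).comp_sub_right w).const_mul (Complex.exp (-(s * w)))
      refine this.congr (Eventually.of_forall fun r => ?_)
      have : Complex.exp (-(s * r)) = Complex.exp (-(s * w)) *
          Complex.exp (-(s * ((r - w : ℝ) : ℂ))) := by
        rw [← Complex.exp_add]; congr 1; push_cast; ring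
      simp only [this]; ring
    have hdiff : (Complex.exp (-(s * w)) - 1) * H =
        ∫ r : ℝ, (k (r - w) - k r) * Complex.exp (-(s * r)) := by
      rw [sub_mul, one_mul, ← hshift, hHdef, ← integral_sub hsi (hint s hs)]
      congr 1 with r; ring
    have h1 : ‖(Complex.exp (-(s * w)) - 1) * H‖ ≤ ∫ r, ‖k (r - w) - k r‖ := by
      rw [hdiff]
      refine norm_integral_le_of_norm_le ((hki.comp_sub_right w).sub hki).norm
        (Eventually.of_forall fun r => ?_)
      rcases le_or_gt r 0 with hr | hr
      · simp [hk0 r hr, hk0 (r - w) (by linarith)]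
      · rw [norm_mul]
        exact mul_le_of_le_one_right (norm_nonneg _) (hnorm s hs r hr.le)
    have hz : ‖-(s * w)‖ = 1 / 2 := by
      rw [norm_neg, norm_mul, Complex.norm_real, Real.norm_of_nonneg hw0.le, hw]
      field_simp
    -- `|e^z - 1| ≥ |z| - |e^z - 1 - z| ≥ |z| - |z|²` at `|z| = 1/2`.
    have h2 : (1 / 4 : ℝ) ≤ ‖Complex.exp (-(s * w)) - 1‖ := by
      have h3 := Complex.norm_exp_sub_one_sub_id_le (x := -(s * w)) (by rw [hz]; norm_num)
      have h4 := norm_sub_norm_le (-(s * w)) (-(s * w) - (Complex.exp (-(s * w)) - 1))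
      rw [sub_sub_cancel, hz, norm_sub_rev] at h4
      rw [hz] at h3
      linarith
    rw [norm_mul] at h1
    nlinarith [norm_nonneg H]
  have ht : Tendsto (fun s : ℂ => 4 * ∫ r, ‖k (r - (2 * ‖s‖)⁻¹) - k r‖)
      (Bornology.cobounded ℂ) (𝓝 0) := by
    have h1 : Tendsto (fun s : ℂ => (2 * ‖s‖)⁻¹) (Bornology.cobounded ℂ) (𝓝 0) :=
      tendsto_inv_atTop_zero.comp (tendsto_norm_cobounded_atTop.const_mul_atTop two_pos)
    simpa using ((tendsto_integral_norm_sub_translate hki).comp h1).const_mul 4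
  refine squeeze_zero_norm' ?_ (ht.mono_left inf_le_left)
  filter_upwards [mem_inf_of_right (mem_principal_self _),
    mem_inf_of_left (Bornology.eventually_ne_cobounded (0 : ℂ))] with s hs hs0
  exact hbound s hs hs0

/-- A Laplace transform is holomorphic in the right half-plane. -/
theorem differentiableAt_laplace {h : ℝ → ℂ}
    (hm : AEStronglyMeasurable h (volume.restrict (Ioi 0)))
    (hi : ∀ δ : ℝ, 0 < δ → IntegrableOn (fun r => ‖h r‖ * Real.exp (-δ * r)) (Ioi 0))
    {s : ℂ} (hs : 0 < s.re) :
    DifferentiableAt ℂ (fun s : ℂ => ∫ r in Ioi (0 : ℝ), h r * Complex.exp (-(s * r))) s := by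
  have hδ : 0 < s.re / 4 := by positivity
  -- On the ball of radius `Re s / 2` the decay rate is at least `2δ`. One `δ` stays in the
  -- dominating function, the other absorbs the factor `r` produced by differentiation.
  set δ := s.re / 4 with hδd
  have hmeas : ∀ s : ℂ, AEStronglyMeasurable (fun r : ℝ => h r * Complex.exp (-(s * r)))
      (volume.restrict (Ioi 0)) := fun s => hm.mul (by fun_prop)
  have hre : ∀ (s : ℂ) (r : ℝ), ‖Complex.exp (-(s * r))‖ = Real.exp (-s.re * r) := fun s r => by
    rw [Complex.norm_exp]; simp
  have := (hasDerivAt_integral_of_dominated_loc_of_deriv_le (𝕜 := ℂ)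
    (μ := volume.restrict (Ioi (0 : ℝ)))
    (F := fun (s : ℂ) (r : ℝ) => h r * Complex.exp (-(s * r)))
    (F' := fun (s : ℂ) (r : ℝ) => h r * (Complex.exp (-(s * r)) * (-(r : ℂ))))
    (bound := fun r => δ⁻¹ * (‖h r‖ * Real.exp (-δ * r))) (x₀ := s)
    (Metric.ball_mem_nhds s (show 0 < s.re / 2 by positivity))
    (Eventually.of_forall fun s => hmeas s) ?_ (hm.mul (by fun_prop)) ?_
    ((hi δ hδ).const_mul _) ?_).2
  · exact this.differentiableAt
  · refine (hi s.re hs).mono' (hmeas s) (Eventually.of_forall fun r => ?_)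
    rw [norm_mul, hre]
  · refine (ae_restrict_iff' measurableSet_Ioi).2 (Eventually.of_forall fun r hr z hz => ?_)
    have hr0 : 0 < r := hr
    have hzre : 2 * δ ≤ z.re := by
      have h1 : |(z - s).re| < s.re / 2 :=
        (Complex.abs_re_le_norm _).trans_lt (by simpa [dist_eq_norm] using hz)
      rw [Complex.sub_re] at h1
      have := (abs_lt.1 h1).1
      rw [hδd]; linarith
    rw [norm_mul, norm_mul, hre, norm_neg, Complex.norm_real, Real.norm_of_nonneg hr0.le]
    have h1 : Real.exp (-z.re * r) * r ≤ δ⁻¹ * Real.exp (-δ * r) := by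
      have h2 : Real.exp (-z.re * r) ≤ Real.exp (-δ * r) * Real.exp (-(δ * r)) := by
        rw [← Real.exp_add]
        exact Real.exp_le_exp.2 (by nlinarith)
      have h3 : Real.exp (-(δ * r)) * (δ * r) ≤ 1 := by
        have h5 := Real.add_one_le_exp (δ * r)
        rw [Real.exp_neg, inv_mul_le_iff₀ (Real.exp_pos _)]
        linarith
      have h4 : Real.exp (-(δ * r)) * r ≤ δ⁻¹ := by
        rw [← one_div, le_div_iff₀ hδ]; linarith
      calc Real.exp (-z.re * r) * r ≤ Real.exp (-δ * r) * Real.exp (-(δ * r)) * r := by gcongr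
        _ = Real.exp (-δ * r) * (Real.exp (-(δ * r)) * r) := by ring
        _ ≤ Real.exp (-δ * r) * δ⁻¹ := by gcongr
        _ = _ := by ring
    calc ‖h r‖ * (Real.exp (-z.re * r) * r) ≤ ‖h r‖ * (δ⁻¹ * Real.exp (-δ * r)) := by gcongr
      _ = _ := by ring
  · refine Eventually.of_forall fun r z _ => ?_
    have h1 : HasDerivAt (fun z : ℂ => -(z * r)) (-(r : ℂ)) z := by
      simpa using ((hasDerivAt_id z).mul_const (r : ℂ)).fun_neg
    exact h1.cexp.const_mul (h r)

/-! ### Fourier inversion for finite measures -/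

section Inversion
open scoped FourierTransform SchwartzMap ComplexOrder

theorem MeasureTheory.Integrable.continuous_fourier {Φ : ℝ → ℂ} (h : Integrable Φ) :
    Continuous (𝓕 Φ) :=
  VectorFourier.fourierIntegral_continuous Real.continuous_fourierChar
    (L := innerₗ ℝ) continuous_inner h

/-- Parseval's relation between a finite measure with integrable characteristic function and a
Schwartz function. -/
theorem integral_schwartz_eq_integral_fourier_charFun (ν : Measure ℝ) [IsFiniteMeasure ν]
    (h : Integrable (fun ξ : ℝ => charFun ν (2 * Real.pi * ξ))) (g : 𝓢(ℝ, ℂ)) :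
    ∫ x, g x ∂ν = ∫ x, 𝓕 (fun ξ : ℝ => charFun ν (2 * Real.pi * ξ)) x * g x := by
  set Φ : ℝ → ℂ := fun ξ => charFun ν (2 * Real.pi * ξ) with hΦ
  have h1 : ∀ ξ : ℝ, VectorFourier.fourierIntegral Real.fourierChar ν (innerₗ ℝ)
      (fun _ => (1 : ℂ)) ξ = Φ (-ξ) := fun ξ => by
    have := charFun_eq_fourierIntegral' (μ := ν) (2 * Real.pi * -ξ)
    rw [hΦ]
    simp only
    rw [this]
    congr 1
    simp only [smul_eq_mul]
    field_simp
  -- Self-adjointness of the Fourier transform is used twice, first between `ν` and `𝓕⁻ g`, then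
  -- between Lebesgue measure with density `Φ` and `g`. The two sides match after the reflection `ξ
  -- ↦ -ξ`, since the characteristic function and the Fourier transform have opposite signs in the
  -- exponent.
  have h2 := VectorFourier.integral_fourierIntegral_smul_eq_flip (L := innerₗ ℝ) (μ := ν)
    (ν := volume) (f := fun _ => (1 : ℂ)) (g := (𝓕⁻ g : 𝓢(ℝ, ℂ)))
    Real.continuous_fourierChar continuous_inner (integrable_const _)
    (𝓕⁻ g : 𝓢(ℝ, ℂ)).integrable
  have h3 : ∀ x : ℝ, VectorFourier.fourierIntegral Real.fourierChar volume (innerₗ ℝ).flip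
      (𝓕⁻ g : 𝓢(ℝ, ℂ)) x = g x := fun x => by
    rw [flip_innerₗ]
    have : (𝓕 (𝓕⁻ g) : 𝓢(ℝ, ℂ)) = g := FourierTransform.fourier_fourierInv_eq g
    exact DFunLike.congr_fun this x
  simp only [h1, h3, smul_eq_mul, one_mul] at h2
  rw [← h2]
  have h4 := VectorFourier.integral_fourierIntegral_smul_eq_flip (L := innerₗ ℝ)
    (μ := volume) (ν := volume) (f := Φ) (g := (g : ℝ → ℂ))
    Real.continuous_fourierChar continuous_inner h g.integrable
  simp only [flip_innerₗ, smul_eq_mul] at h4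
  refine Eq.trans ?_ h4.symm
  rw [← integral_neg_eq_self]
  refine integral_congr_ae (Eventually.of_forall fun ξ => ?_)
  simp only [neg_neg]
  congr 1
  rw [SchwartzMap.fourierInv_coe, Real.fourierInv_eq_fourier_neg, neg_neg]
  rfl

/-- A finite measure on the line with integrable characteristic function has a continuous
nonnegative density, given by Fourier inversion. -/
theorem eq_withDensity_fourier_charFun (ν : Measure ℝ) [IsFiniteMeasure ν]
    (h : Integrable (fun ξ : ℝ => charFun ν (2 * Real.pi * ξ))) :
    (∀ x, 0 ≤ 𝓕 (fun ξ : ℝ => charFun ν (2 * Real.pi * ξ)) x) ∧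
    ν = volume.withDensity
      (fun x => ENNReal.ofReal (𝓕 (fun ξ : ℝ => charFun ν (2 * Real.pi * ξ)) x).re) := by
  set Φ : ℝ → ℂ := fun ξ => charFun ν (2 * Real.pi * ξ) with hΦ
  have hcont : Continuous (𝓕 Φ) := h.continuous_fourier
  have htest : ∀ g : ℝ → ℝ, HasCompactSupport g → ContDiff ℝ (⊤ : ℕ∞) g →
      ∫ x, 𝓕 Φ x * (g x : ℂ) = ((∫ x, g x ∂ν : ℝ) : ℂ) := fun g hg1 hg2 => by
    have c1 : HasCompactSupport (fun x => (g x : ℂ)) := hg1.comp_left Complex.ofReal_zero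
    have c2 : ContDiff ℝ (⊤ : ℕ∞) (fun x => (g x : ℂ)) :=
      Complex.ofRealCLM.contDiff.comp hg2
    have := integral_schwartz_eq_integral_fourier_charFun ν h (c1.toSchwartzMap c2)
    simp only [HasCompactSupport.toSchwartzMap_toFun] at this
    rw [← integral_complex_ofReal]
    exact this.symm
  have hpos : ∀ x, 0 ≤ 𝓕 Φ x := by
    intro x
    -- An approximate identity centred at `x` recovers `𝓕 Φ x` as a limit of integrals of
    -- nonnegative bumps against `ν`.
    let φ : ℕ → ContDiffBump (0 : ℝ) := fun n => ⟨1 / (n + 1) / 2, 1 / (n + 1), by positivity,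
      half_lt_self (by positivity)⟩
    have hφ : Tendsto (fun n => (φ n).rOut) atTop (𝓝 0) := tendsto_one_div_add_atTop_nhds_zero_nat
    have hlim := ContDiffBump.convolution_tendsto_right_of_continuous (μ := volume) hφ hcont x
    refine ge_of_tendsto hlim (Eventually.of_forall fun n => ?_)
    rw [MeasureTheory.convolution_eq_swap]
    have h1 := htest (fun t => (φ n).normed volume (x - t))
      ((φ n).hasCompactSupport_normed.comp_homeomorph (Homeomorph.subLeft x))
      ((φ n).contDiff_normed.comp (contDiff_const.sub contDiff_id))
    have h2 : ∫ t, (ContinuousLinearMap.lsmul ℝ ℝ) ((φ n).normed volume (x - t)) (𝓕 Φ t)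
        = ∫ t, 𝓕 Φ t * (((φ n).normed volume (x - t) : ℝ) : ℂ) := by
      congr 1 with t
      simp [mul_comm]
    rw [h2, h1]
    exact Complex.zero_le_real.2 (integral_nonneg fun t => (φ n).nonneg_normed _)
  refine ⟨hpos, ?_⟩
  have hre0 : ∀ x, 0 ≤ (𝓕 Φ x).re := fun x => (Complex.le_def.1 (hpos x)).1
  have hreal : ∀ x, 𝓕 Φ x = ((𝓕 Φ x).re : ℂ) := fun x =>
    Complex.ext rfl (by simpa using (Complex.le_def.1 (hpos x)).2.symm)
  have hrecont : Continuous fun x => (𝓕 Φ x).re := Complex.continuous_re.comp hcont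
  have hint : Integrable (fun x => (𝓕 Φ x).re) := by
    refine integrable_of_intervalIntegral_norm_bounded (a := fun n : ℕ => -((n : ℝ) + 1))
      (b := fun n : ℕ => (n : ℝ) + 1) (l := atTop) (ν.real univ)
      (fun n => hrecont.continuousOn.integrableOn_Icc.mono_set Ioc_subset_Icc_self)
      (tendsto_neg_atTop_atBot.comp (tendsto_atTop_add_const_right _ _ tendsto_natCast_atTop_atTop))
      (tendsto_atTop_add_const_right _ _ tendsto_natCast_atTop_atTop)
      (Eventually.of_forall fun n => ?_)
    -- A bump equal to `1` on the interval bounds the integral of the nonnegative `𝓕 Φ` there by the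
    -- total mass of `ν`, uniformly in `n`.
    let φ : ContDiffBump (0 : ℝ) := ⟨n + 1, n + 2, by positivity, by linarith⟩
    have h1 := htest φ φ.hasCompactSupport φ.contDiff
    have h2 : ∫ x, (𝓕 Φ x).re * φ x = ∫ x, φ x ∂ν := by
      have h3 : ∫ x, 𝓕 Φ x * (φ x : ℂ) = ((∫ x, (𝓕 Φ x).re * φ x : ℝ) : ℂ) := by
        rw [← integral_complex_ofReal]
        congr 1 with x
        rw [Complex.ofReal_mul, ← hreal x]
      rw [h3] at h1
      exact_mod_cast h1
    have hφi : Integrable (fun x => (𝓕 Φ x).re * φ x) :=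
      (hrecont.mul φ.continuous).integrable_of_hasCompactSupport φ.hasCompactSupport.mul_left
    rw [intervalIntegral.integral_of_le (by linarith [n.cast_nonneg (α := ℝ)])]
    calc ∫ x in Ioc (-((n : ℝ) + 1)) (n + 1), ‖(𝓕 Φ x).re‖
        = ∫ x in Ioc (-((n : ℝ) + 1)) (n + 1), (𝓕 Φ x).re * φ x := by
          refine setIntegral_congr_fun measurableSet_Ioc fun x hx => ?_
          have : φ x = 1 := φ.one_of_mem_closedBall (by
            rw [mem_closedBall_zero_iff, Real.norm_eq_abs]
            exact abs_le.2 ⟨hx.1.le, hx.2⟩)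
          simp only [this, mul_one, Real.norm_of_nonneg (hre0 x)]
      _ ≤ ∫ x, (𝓕 Φ x).re * φ x :=
          setIntegral_le_integral hφi (Eventually.of_forall fun x => mul_nonneg (hre0 x) φ.nonneg)
      _ = ∫ x, φ x ∂ν := h2
      _ ≤ ∫ x, (1 : ℝ) ∂ν := integral_mono_of_nonneg (Eventually.of_forall fun x => φ.nonneg)
          (integrable_const _) (Eventually.of_forall fun x => φ.le_one)
      _ = ν.real univ := by simp
  have hintC : Integrable (𝓕 Φ) := by
    have := hint.ofReal (𝕜 := ℂ)
    exact this.congr (Eventually.of_forall fun x => (hreal x).symm)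
  have hΦc : Continuous Φ := by
    have : Continuous (charFun ν) := continuous_charFun
    exact this.comp (by fun_prop)
  -- With `𝓕 Φ` now known to be integrable, inversion gives the measure with this density the same
  -- characteristic function as `ν`, hence the two coincide.
  have hinv : 𝓕⁻ (𝓕 Φ) = Φ := hΦc.fourierInv_fourier_eq h hintC
  have : IsFiniteMeasure (volume.withDensity fun x => ENNReal.ofReal (𝓕 Φ x).re) :=
    isFiniteMeasure_withDensity_ofReal hint.2
  refine Measure.ext_of_charFun (funext fun t => ?_)
  have h1 : charFun ν t = Φ ((2 * Real.pi)⁻¹ * t) := by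
    simp only [hΦ]; congr 1; field_simp
  rw [h1, ← congrFun hinv, Real.fourierInv_eq', charFun_apply_real,
    integral_withDensity_eq_integral_toReal_smul hrecont.measurable.ennreal_ofReal (by simp)]
  congr 1 with x
  rw [ENNReal.toReal_ofReal (hre0 x), smul_eq_mul, Complex.real_smul, ← hreal x, mul_comm]
  congr 2
  simp only [RCLike.inner_apply, conj_trivial]
  push_cast
  field_simp

end Inversion

/-! ### Laplace transforms along the rays of the sector -/

theorem re_mul_exp_mul_I (z : ℂ) (ω : ℝ) :
    (z * Complex.exp (ω * Complex.I)).re = ‖z‖ * Real.cos (z.arg + ω) := by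
  conv_lhs => rw [← Complex.norm_mul_exp_arg_mul_I z, mul_assoc, ← Complex.exp_add, ← add_mul,
    ← Complex.ofReal_add]
  rw [Complex.re_ofReal_mul, Complex.exp_ofReal_mul_I_re]

theorem arg_mul_exp_mul_I {r ω : ℝ} (hr : 0 < r) (hω : ω ∈ Ioc (-Real.pi) Real.pi) :
    ((r : ℂ) * Complex.exp (ω * Complex.I)).arg = ω := by
  rw [Complex.exp_mul_I]
  exact Complex.arg_mul_cos_add_sin_mul_I hr hω

theorem norm_mul_exp_mul_I {r : ℝ} (hr : 0 < r) (ω : ℝ) :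
    ‖(r : ℂ) * Complex.exp (ω * Complex.I)‖ = r := by
  simp [abs_of_pos hr]

theorem mul_exp_mul_I_mem_sectorW {ψ r ω : ℝ} (hψ : ψ < Real.pi) (hr : 0 < r) (hω : |ω| ≤ ψ) :
    (r : ℂ) * Complex.exp (ω * Complex.I) ∈ sectorW ψ := by
  refine ⟨mul_ne_zero (by exact_mod_cast hr.ne') (Complex.exp_ne_zero _), ?_⟩
  rw [arg_mul_exp_mul_I hr]
  · exact hω
  · have := abs_le.1 hω
    exact ⟨by linarith, by linarith⟩

theorem re_pos_of_mem_sectorW {ψ : ℝ} (hψ : ψ < Real.pi / 2) {z : ℂ} (hz : z ∈ sectorW ψ) :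
    0 < z.re := by
  have h1 := abs_le.1 hz.2
  rw [← Complex.norm_mul_cos_arg]
  exact mul_pos (norm_pos_iff.2 hz.1) (Real.cos_pos_of_mem_Ioo ⟨by linarith, by linarith⟩)

/-- The integral `∫ g(z) e^{-θz} dz` along the ray `arg z = ω`. -/
noncomputable def rayLaplace (g : ℂ → ℂ) (ω : ℝ) (θ : ℂ) : ℂ :=
  ∫ r in Ioi (0 : ℝ), g (r * Complex.exp (ω * Complex.I)) *
    Complex.exp (-(θ * (r * Complex.exp (ω * Complex.I)))) * Complex.exp (ω * Complex.I)

theorem integrableOn_one_add_rpow_mul_exp {β δ : ℝ} (hβ : -1 < β) (hδ : 0 < δ) :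
    IntegrableOn (fun r : ℝ => (1 + r ^ β) * Real.exp (-δ * r)) (Ioi 0) := by
  have h1 := integrableOn_rpow_mul_exp_neg_mul_rpow (p := 1) (s := 0) (by norm_num) one_pos hδ
  have h2 := integrableOn_rpow_mul_exp_neg_mul_rpow (p := 1) hβ one_pos hδ
  refine (h1.add h2).congr_fun (fun r _ => ?_) measurableSet_Ioi
  simp only [Pi.add_apply, Real.rpow_one, Real.rpow_zero]
  ring

section RayLaplace

variable {g : ℂ → ℂ} {ψ β γ M : ℝ}

/-- The growth `e^(γ Re z)` merges with `e^(-θz)` into `e^(-(θ-γ)z)`. This is why convergence on the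
ray of direction `ω` is governed by the half-plane `Re ((θ - γ) e^(iω)) > 0`. -/
theorem norm_mul_cexp_le_of_bound (hψ0 : ψ < Real.pi)
    (hgb : ∀ z ∈ sectorW ψ, ‖g z‖ ≤ M * (1 + ‖z‖ ^ β) * Real.exp (γ * z.re))
    {ω : ℝ} (hω : |ω| ≤ ψ) (θ : ℂ) {r : ℝ} (hr : 0 < r) :
    ‖g (r * Complex.exp (ω * Complex.I)) *
      Complex.exp (-(θ * (r * Complex.exp (ω * Complex.I))))‖ ≤
    M * ((1 + r ^ β) * Real.exp (-((θ - γ) * Complex.exp (ω * Complex.I)).re * r)) := by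
  have h1 := hgb _ (mul_exp_mul_I_mem_sectorW hψ0 hr hω)
  rw [norm_mul_exp_mul_I hr] at h1
  rw [norm_mul, Complex.norm_exp]
  refine (mul_le_mul_of_nonneg_right h1 (Real.exp_pos _).le).trans (le_of_eq ?_)
  rw [mul_assoc, ← Real.exp_add, mul_assoc]
  congr 3
  have h2 : ((θ - γ) * Complex.exp (ω * Complex.I)).re * r =
      (θ * (r * Complex.exp (ω * Complex.I))).re
        - γ * (r * Complex.exp (ω * Complex.I)).re := by
    rw [← Complex.re_ofReal_mul γ, ← Complex.sub_re, ← Complex.re_mul_ofReal]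
    congr 1; ring
  rw [Complex.neg_re]
  linarith

theorem continuousOn_comp_ray (hψ0 : ψ < Real.pi)
    (hgd : ∀ z ∈ sectorW ψ, DifferentiableAt ℂ g z) {ω : ℝ} (hω : |ω| ≤ ψ) :
    ContinuousOn (fun r : ℝ => g (r * Complex.exp (ω * Complex.I))) (Ioi 0) := by
  intro r hr
  have h1 : ContinuousAt (fun r : ℝ => (r : ℂ) * Complex.exp (ω * Complex.I)) r := by fun_prop
  exact (ContinuousAt.comp (f := fun r : ℝ => (r : ℂ) * Complex.exp (ω * Complex.I)) (g := g)
    (hgd _ (mul_exp_mul_I_mem_sectorW hψ0 hr hω)).continuousAt h1).continuousWithinAt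

theorem integrableOn_mul_cexp_ray (hψ0 : ψ < Real.pi) (hβ : -1 < β)
    (hgd : ∀ z ∈ sectorW ψ, DifferentiableAt ℂ g z)
    (hgb : ∀ z ∈ sectorW ψ, ‖g z‖ ≤ M * (1 + ‖z‖ ^ β) * Real.exp (γ * z.re))
    {ω : ℝ} (hω : |ω| ≤ ψ) {θ : ℂ} (hθ : 0 < ((θ - γ) * Complex.exp (ω * Complex.I)).re) :
    IntegrableOn (fun r : ℝ => g (r * Complex.exp (ω * Complex.I)) *
      Complex.exp (-(θ * (r * Complex.exp (ω * Complex.I))))) (Ioi 0) := by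
  refine ((integrableOn_one_add_rpow_mul_exp hβ hθ).const_mul M).mono' ?_ ?_
  · exact ((continuousOn_comp_ray hψ0 hgd hω).mul (by fun_prop)).aestronglyMeasurable
      measurableSet_Ioi
  · exact (ae_restrict_iff' measurableSet_Ioi).2 (Eventually.of_forall fun r hr =>
      norm_mul_cexp_le_of_bound hψ0 hgb hω θ hr)

/-- Absorbing `e^(-cz)` into the density leaves an ordinary Laplace transform in `(θ - c) e^(iω)`.
The base point `c = γ` serves for holomorphy in the open half-plane; a base point strictly inside
makes the density integrable, as needed for bounds and limits on a closed half-plane. -/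
theorem rayLaplace_eq_laplace (g : ℂ → ℂ) (ω : ℝ) (θ c : ℂ) :
    rayLaplace g ω θ = ∫ r in Ioi (0 : ℝ), (g (r * Complex.exp (ω * Complex.I)) *
      Complex.exp (-(c * (r * Complex.exp (ω * Complex.I)))) * Complex.exp (ω * Complex.I)) *
      Complex.exp (-((θ - c) * Complex.exp (ω * Complex.I) * r)) := by
  unfold rayLaplace
  congr 1 with r
  have : Complex.exp (-(θ * (r * Complex.exp (ω * Complex.I)))) =
      Complex.exp (-(c * (r * Complex.exp (ω * Complex.I)))) *
      Complex.exp (-((θ - c) * Complex.exp (ω * Complex.I) * r)) := by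
    rw [← Complex.exp_add]; congr 1; ring
  rw [this]; ring

theorem differentiableAt_rayLaplace (hψ0 : ψ < Real.pi) (hβ : -1 < β)
    (hgd : ∀ z ∈ sectorW ψ, DifferentiableAt ℂ g z)
    (hgb : ∀ z ∈ sectorW ψ, ‖g z‖ ≤ M * (1 + ‖z‖ ^ β) * Real.exp (γ * z.re))
    {ω : ℝ} (hω : |ω| ≤ ψ) {θ : ℂ} (hθ : 0 < ((θ - γ) * Complex.exp (ω * Complex.I)).re) :
    DifferentiableAt ℂ (rayLaplace g ω) θ := by
  set h : ℝ → ℂ := fun r => g (r * Complex.exp (ω * Complex.I)) *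
      Complex.exp (-((γ : ℂ) * (r * Complex.exp (ω * Complex.I)))) * Complex.exp (ω * Complex.I)
    with hh
  have hm : AEStronglyMeasurable h (volume.restrict (Ioi 0)) :=
    (((continuousOn_comp_ray hψ0 hgd hω).mul (by fun_prop)).mul
      continuousOn_const).aestronglyMeasurable measurableSet_Ioi
  have hi : ∀ δ : ℝ, 0 < δ → IntegrableOn (fun r => ‖h r‖ * Real.exp (-δ * r)) (Ioi 0) := by
    intro δ hδ
    refine ((integrableOn_one_add_rpow_mul_exp hβ hδ).const_mul M).mono'
      (hm.norm.mul (by fun_prop)) ?_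
    refine (ae_restrict_iff' measurableSet_Ioi).2 (Eventually.of_forall fun r hr => ?_)
    have h1 := norm_mul_cexp_le_of_bound hψ0 hgb hω (γ : ℂ) (mem_Ioi.1 hr)
    rw [sub_self, zero_mul, Complex.zero_re, neg_zero, zero_mul, Real.exp_zero, mul_one] at h1
    rw [norm_mul, norm_norm, Real.norm_of_nonneg (Real.exp_pos _).le, hh, norm_mul,
      Complex.norm_exp_ofReal_mul_I, mul_one]
    exact (mul_le_mul_of_nonneg_right h1 (Real.exp_pos _).le).trans_eq (mul_assoc _ _ _)
  have h1 : rayLaplace g ω = fun θ => (fun s : ℂ => ∫ r in Ioi (0 : ℝ),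
      h r * Complex.exp (-(s * r))) ((θ - γ) * Complex.exp (ω * Complex.I)) := by
    funext θ
    exact rayLaplace_eq_laplace g ω θ γ
  rw [h1]
  exact DifferentiableAt.comp (g := fun s : ℂ => ∫ r in Ioi (0 : ℝ),
      h r * Complex.exp (-(s * r))) θ (differentiableAt_laplace hm hi hθ) (by fun_prop)

theorem tendsto_rayLaplace (hψ0 : ψ < Real.pi) (hβ : -1 < β)
    (hgd : ∀ z ∈ sectorW ψ, DifferentiableAt ℂ g z)
    (hgb : ∀ z ∈ sectorW ψ, ‖g z‖ ≤ M * (1 + ‖z‖ ^ β) * Real.exp (γ * z.re))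
    {ω : ℝ} (hω : |ω| ≤ ψ) {c : ℂ} (hc : 0 < ((c - γ) * Complex.exp (ω * Complex.I)).re) :
    Tendsto (rayLaplace g ω) (Bornology.cobounded ℂ ⊓
      𝓟 {θ | 0 ≤ ((θ - c) * Complex.exp (ω * Complex.I)).re}) (𝓝 0) := by
  have h1 := tendsto_laplace_cobounded_halfPlane
    ((integrableOn_mul_cexp_ray hψ0 hβ hgd hgb hω hc).mul_const (Complex.exp (ω * Complex.I)))
  have h2 : rayLaplace g ω = fun θ => (fun s : ℂ => ∫ r in Ioi (0 : ℝ),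
      (g (r * Complex.exp (ω * Complex.I)) *
        Complex.exp (-(c * (r * Complex.exp (ω * Complex.I)))) * Complex.exp (ω * Complex.I)) *
      Complex.exp (-(s * r))) ((θ - c) * Complex.exp (ω * Complex.I)) := by
    funext θ
    exact rayLaplace_eq_laplace g ω θ c
  rw [h2]
  refine h1.comp (tendsto_inf.2 ⟨?_, ?_⟩)
  · refine Tendsto.mono_left ?_ inf_le_left
    rw [← tendsto_norm_atTop_iff_cobounded]
    simp only [norm_mul, Complex.norm_exp_ofReal_mul_I, mul_one]
    refine tendsto_atTop_mono (fun θ => norm_sub_norm_le θ c) ?_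
    exact tendsto_atTop_add_const_right _ _ tendsto_norm_cobounded_atTop
  · exact tendsto_principal.2 (mem_inf_of_right (mem_principal_self _))

theorem exists_norm_rayLaplace_le (hψ0 : ψ < Real.pi) (hβ : -1 < β)
    (hgd : ∀ z ∈ sectorW ψ, DifferentiableAt ℂ g z)
    (hgb : ∀ z ∈ sectorW ψ, ‖g z‖ ≤ M * (1 + ‖z‖ ^ β) * Real.exp (γ * z.re))
    {ω : ℝ} (hω : |ω| ≤ ψ) {c : ℂ} (hc : 0 < ((c - γ) * Complex.exp (ω * Complex.I)).re) :
    ∃ C, ∀ θ : ℂ, 0 ≤ ((θ - c) * Complex.exp (ω * Complex.I)).re → ‖rayLaplace g ω θ‖ ≤ C := by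
  refine ⟨∫ r in Ioi (0 : ℝ), ‖g (r * Complex.exp (ω * Complex.I)) *
    Complex.exp (-(c * (r * Complex.exp (ω * Complex.I)))) * Complex.exp (ω * Complex.I)‖,
    fun θ hθ => ?_⟩
  rw [rayLaplace_eq_laplace g ω θ c]
  refine norm_integral_le_of_norm_le ((integrableOn_mul_cexp_ray hψ0 hβ hgd hgb hω hc).mul_const
    (Complex.exp (ω * Complex.I))).norm ?_
  refine (ae_restrict_iff' measurableSet_Ioi).2 (Eventually.of_forall fun r hr => ?_)
  rw [norm_mul]
  refine mul_le_of_le_one_right (norm_nonneg _) ?_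
  rw [Complex.norm_exp, Complex.neg_re, Complex.re_mul_ofReal]
  exact Real.exp_le_one_iff.2 (neg_nonpos.2 (mul_nonneg hθ (le_of_lt hr)))

/-- A linear functional of `e^{iω}` on an arc shorter than `π` is bounded below by its smaller
end value, if that is nonnegative. -/
theorem min_le_re_mul_exp_of_mem_Icc {w : ℂ} {ω₁ ω₂ ω : ℝ} (hω : ω ∈ Icc ω₁ ω₂)
    (hlen : ω₂ - ω₁ < Real.pi)
    (h₁ : 0 < (w * Complex.exp (ω₁ * Complex.I)).re)
    (h₂ : 0 < (w * Complex.exp (ω₂ * Complex.I)).re) :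
    min (w * Complex.exp (ω₁ * Complex.I)).re (w * Complex.exp (ω₂ * Complex.I)).re ≤
      (w * Complex.exp (ω * Complex.I)).re := by
  rcases eq_or_lt_of_le (hω.1.trans hω.2) with he | hlt
  · have : ω = ω₁ := le_antisymm (by linarith [hω.2]) hω.1
    rw [this]; exact min_le_left _ _
  set x₁ := (w * Complex.exp (ω₁ * Complex.I)).re with hx₁
  set x₂ := (w * Complex.exp (ω₂ * Complex.I)).re with hx₂
  have hs : 0 < Real.sin (ω₂ - ω₁) := Real.sin_pos_of_pos_of_lt_pi (by linarith) hlen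
  have hA : 0 ≤ Real.sin (ω₂ - ω) :=
    Real.sin_nonneg_of_nonneg_of_le_pi (by linarith [hω.2]) (by linarith [hω.1])
  have hB : 0 ≤ Real.sin (ω - ω₁) :=
    Real.sin_nonneg_of_nonneg_of_le_pi (by linarith [hω.1]) (by linarith [hω.2])
  -- With `w e^(iω)` expanded, the real part is a sinusoid in `ω`, so it is interpolated from its
  -- end values with sine weights. These weights are nonnegative on an arc shorter than `π`, and by
  -- `hsub` they total at least `sin (ω₂ - ω₁)`.
  have hid : (w * Complex.exp (ω * Complex.I)).re * Real.sin (ω₂ - ω₁) =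
      Real.sin (ω₂ - ω) * x₁ + Real.sin (ω - ω₁) * x₂ := by
    rw [hx₁, hx₂]
    simp only [Complex.mul_re, Complex.exp_ofReal_mul_I_re, Complex.exp_ofReal_mul_I_im,
      Real.sin_sub]
    ring
  have hsub : Real.sin (ω₂ - ω₁) ≤ Real.sin (ω₂ - ω) + Real.sin (ω - ω₁) := by
    have : ω₂ - ω₁ = (ω₂ - ω) + (ω - ω₁) := by ring
    rw [this, Real.sin_add]
    have h3 := mul_le_of_le_one_right hA (Real.cos_le_one (ω - ω₁))
    have h4 := mul_le_of_le_one_left hB (Real.cos_le_one (ω₂ - ω))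
    linarith
  have hm : 0 < min x₁ x₂ := lt_min h₁ h₂
  refine le_of_mul_le_mul_right ?_ hs
  rw [hid]
  nlinarith [mul_le_mul_of_nonneg_left (min_le_left x₁ x₂) hA,
    mul_le_mul_of_nonneg_left (min_le_right x₁ x₂) hB, mul_le_mul_of_nonneg_left hsub hm.le]

/-- Positivity of the decay rate at the two end directions gives the common rate `δ` in every
direction between them, so `z g(z) e^(-θz)` vanishes uniformly on large arcs. On small arcs `β > -1`
does the same. -/
theorem rayLaplace_eq_rayLaplace (hψ0 : ψ < Real.pi / 2) (hβ : -1 < β)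
    (hgd : ∀ z ∈ sectorW ψ, DifferentiableAt ℂ g z)
    (hgb : ∀ z ∈ sectorW ψ, ‖g z‖ ≤ M * (1 + ‖z‖ ^ β) * Real.exp (γ * z.re))
    {ω₁ ω₂ : ℝ} (h₁ : -ψ ≤ ω₁) (h₁₂ : ω₁ ≤ ω₂) (h₂ : ω₂ ≤ ψ) {θ : ℂ}
    (hθ₁ : 0 < ((θ - γ) * Complex.exp (ω₁ * Complex.I)).re)
    (hθ₂ : 0 < ((θ - γ) * Complex.exp (ω₂ * Complex.I)).re) :
    rayLaplace g ω₁ θ = rayLaplace g ω₂ θ := by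
  have hπ := Real.pi_pos
  have hψπ : ψ < Real.pi := by linarith
  have habs : ∀ ω ∈ Icc ω₁ ω₂, |ω| ≤ ψ := fun ω hω =>
    abs_le.2 ⟨h₁.trans hω.1, hω.2.trans h₂⟩
  set δ := min ((θ - γ) * Complex.exp (ω₁ * Complex.I)).re
    ((θ - γ) * Complex.exp (ω₂ * Complex.I)).re with hδ
  have hδ0 : 0 < δ := lt_min hθ₁ hθ₂
  have hM : 0 ≤ M := by
    have h3 := hgb _ (mul_exp_mul_I_mem_sectorW hψπ one_pos (habs ω₁ ⟨le_rfl, h₁₂⟩))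
    have h4 := (norm_nonneg _).trans h3
    rw [norm_mul_exp_mul_I one_pos, Real.one_rpow] at h4
    by_contra hneg
    have := mul_neg_of_neg_of_pos (mul_neg_of_neg_of_pos (not_le.1 hneg)
      (show (0 : ℝ) < 1 + 1 by norm_num))
      (Real.exp_pos (γ * (((1 : ℝ) : ℂ) * Complex.exp (ω₁ * Complex.I)).re))
    linarith
  refine integral_ray_eq_integral_ray (f := fun z => g z * Complex.exp (-(θ * z))) h₁₂ ?_
    (B := fun r => M * ((r + r ^ (1 + β)) * Real.exp (-δ * r))) ?_ ?_ ?_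
    (integrableOn_mul_cexp_ray hψπ hβ hgd hgb (habs _ ⟨le_rfl, h₁₂⟩) hθ₁)
    (integrableOn_mul_cexp_ray hψπ hβ hgd hgb (habs _ ⟨h₁₂, le_rfl⟩) hθ₂)
  · intro r hr ω hω
    have := hgd _ (mul_exp_mul_I_mem_sectorW hψπ hr (habs ω hω))
    exact this.mul (by fun_prop)
  · intro r hr ω hω
    have h3 := norm_mul_cexp_le_of_bound hψπ hgb (habs ω hω) θ hr
    have h4 := min_le_re_mul_exp_of_mem_Icc hω (by linarith) hθ₁ hθ₂
    have h5 : Real.exp (-((θ - γ) * Complex.exp (ω * Complex.I)).re * r) ≤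
        Real.exp (-δ * r) :=
      Real.exp_le_exp.2 (mul_le_mul_of_nonneg_right (neg_le_neg h4) hr.le)
    have hrβ : 0 ≤ r ^ β := Real.rpow_nonneg hr.le _
    calc r * ‖g (r * Complex.exp (ω * Complex.I)) *
          Complex.exp (-(θ * (r * Complex.exp (ω * Complex.I))))‖
        ≤ r * (M * ((1 + r ^ β) * Real.exp (-δ * r))) := by
          refine mul_le_mul_of_nonneg_left (h3.trans ?_) hr.le
          gcongr
      _ = M * ((r + r ^ (1 + β)) * Real.exp (-δ * r)) := by
          rw [Real.rpow_add hr, Real.rpow_one]; ring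
  · have hc : ContinuousAt (fun r : ℝ => M * ((r + r ^ (1 + β)) * Real.exp (-δ * r))) 0 := by
      have := Real.continuousAt_rpow_const 0 (1 + β) (Or.inr (by linarith))
      fun_prop
    have := hc.tendsto
    simp only [Real.zero_rpow (show 1 + β ≠ 0 by linarith), add_zero, zero_mul, mul_zero] at this
    exact this.mono_left nhdsWithin_le_nhds
  · have h3 := tendsto_rpow_mul_exp_neg_mul_atTop_nhds_zero 1 δ hδ0
    have h4 := tendsto_rpow_mul_exp_neg_mul_atTop_nhds_zero (1 + β) δ hδ0
    have := (h3.add h4).const_mul M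
    simp only [add_zero, mul_zero, Real.rpow_one, ← add_mul] at this
    exact this

end RayLaplace

/-! ### Geometry of the cones -/

/-- The angle `arg z - ψ` lies in `(-π - ψ, π - ψ]`. Since `ψ < π/2`, this range stays above
`-3π/2`, so a positive cosine confines the angle to `(-π/2, π/2)`. -/
theorem abs_arg_lt_of_re_mul_exp_neg_pos {ψ : ℝ} (hψ0 : 0 < ψ) (hψ1 : ψ < Real.pi / 2) {z : ℂ}
    (hz : 0 < (z * Complex.exp ((-ψ : ℝ) * Complex.I)).re) : |z.arg| < Real.pi / 2 + ψ := by
  rw [re_mul_exp_mul_I] at hz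
  have hc : 0 < Real.cos (z.arg + -ψ) := by
    by_contra h
    exact absurd hz (not_lt.2 (mul_nonpos_of_nonneg_of_nonpos (norm_nonneg z) (not_lt.1 h)))
  have h1 := Complex.neg_pi_lt_arg z
  have h2 := Complex.arg_le_pi z
  have hπ := Real.pi_pos
  refine abs_lt.2 ⟨?_, ?_⟩
  · by_contra h
    have := Real.cos_nonpos_of_pi_div_two_le_of_le (x := -(z.arg + -ψ)) (by linarith) (by linarith)
    rw [Real.cos_neg] at this
    linarith
  · by_contra h
    have := Real.cos_nonpos_of_pi_div_two_le_of_le (x := z.arg + -ψ) (by linarith) (by linarith)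
    linarith

theorem abs_arg_lt_of_re_mul_exp_pos {ψ : ℝ} (hψ0 : 0 < ψ) (hψ1 : ψ < Real.pi / 2) {z : ℂ}
    (hz : 0 < (z * Complex.exp ((ψ : ℝ) * Complex.I)).re) : |z.arg| < Real.pi / 2 + ψ := by
  rw [re_mul_exp_mul_I] at hz
  have hc : 0 < Real.cos (z.arg + ψ) := by
    by_contra h
    exact absurd hz (not_lt.2 (mul_nonpos_of_nonneg_of_nonpos (norm_nonneg z) (not_lt.1 h)))
  have h1 := Complex.neg_pi_lt_arg z
  have h2 := Complex.arg_le_pi z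
  have hπ := Real.pi_pos
  refine abs_lt.2 ⟨?_, ?_⟩
  · by_contra h
    have := Real.cos_nonpos_of_pi_div_two_le_of_le (x := -(z.arg + ψ)) (by linarith) (by linarith)
    rw [Real.cos_neg] at this
    linarith
  · by_contra h
    have := Real.cos_nonpos_of_pi_div_two_le_of_le (x := z.arg + ψ) (by linarith) (by linarith)
    linarith

theorem mem_openCone_of_re_mul_exp_neg_pos {γ ψ : ℝ} (hψ0 : 0 < ψ) (hψ1 : ψ < Real.pi / 2) {θ : ℂ}
    (h : 0 < ((θ - γ) * Complex.exp ((-ψ : ℝ) * Complex.I)).re) :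
    θ ∈ openCone γ (Real.pi / 2 + ψ) :=
  ⟨fun he => by simp [he] at h, abs_arg_lt_of_re_mul_exp_neg_pos hψ0 hψ1 h⟩

theorem mem_openCone_of_re_mul_exp_pos {γ ψ : ℝ} (hψ0 : 0 < ψ) (hψ1 : ψ < Real.pi / 2) {θ : ℂ}
    (h : 0 < ((θ - γ) * Complex.exp ((ψ : ℝ) * Complex.I)).re) :
    θ ∈ openCone γ (Real.pi / 2 + ψ) :=
  ⟨fun he => by simp [he] at h, abs_arg_lt_of_re_mul_exp_pos hψ0 hψ1 h⟩

theorem re_mul_exp_neg_pos_of_mem_openCone {γ ψ : ℝ} (hψ1 : ψ < Real.pi / 2) {θ : ℂ}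
    (h : θ ∈ openCone γ (Real.pi / 2 + ψ)) (him : 0 ≤ θ.im) :
    0 < ((θ - γ) * Complex.exp ((-ψ : ℝ) * Complex.I)).re := by
  rw [re_mul_exp_mul_I]
  have h1 : 0 ≤ (θ - γ).arg := Complex.arg_nonneg_iff.2 (by simpa using him)
  have h2 := (abs_lt.1 h.2).2
  exact mul_pos (norm_pos_iff.2 (sub_ne_zero.2 h.1))
    (Real.cos_pos_of_mem_Ioo ⟨by linarith, by linarith⟩)

theorem re_mul_exp_pos_of_mem_openCone {γ ψ : ℝ} (hψ1 : ψ < Real.pi / 2) {θ : ℂ}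
    (h : θ ∈ openCone γ (Real.pi / 2 + ψ)) (him : θ.im < 0) :
    0 < ((θ - γ) * Complex.exp ((ψ : ℝ) * Complex.I)).re := by
  rw [re_mul_exp_mul_I]
  have h1 : (θ - γ).arg < 0 := Complex.arg_neg_iff.2 (by simpa using him)
  have h2 := (abs_lt.1 h.2).1
  exact mul_pos (norm_pos_iff.2 (sub_ne_zero.2 h.1))
    (Real.cos_pos_of_mem_Ioo ⟨by linarith, by linarith⟩)

/-- Each half of the cone, above and below the real axis, lies in one of the two rotated
half-planes. This lets estimates on the cone be read off from estimates on half-planes. -/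
theorem re_mul_exp_neg_nonneg_of_mem_closedCone {c ψ : ℝ} (hψ1 : ψ < Real.pi / 2)
    {θ : ℂ} (h : θ ∈ closedCone c (Real.pi / 2 + ψ)) (him : 0 ≤ θ.im) :
    0 ≤ ((θ - c) * Complex.exp ((-ψ : ℝ) * Complex.I)).re := by
  rw [re_mul_exp_mul_I]
  have h1 : 0 ≤ (θ - c).arg := Complex.arg_nonneg_iff.2 (by simpa using him)
  have h2 := (abs_le.1 (mem_ofPred.1 h)).2
  exact mul_nonneg (norm_nonneg _) (Real.cos_nonneg_of_mem_Icc ⟨by linarith, by linarith⟩)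

theorem re_mul_exp_nonneg_of_mem_closedCone {c ψ : ℝ} (hψ1 : ψ < Real.pi / 2)
    {θ : ℂ} (h : θ ∈ closedCone c (Real.pi / 2 + ψ)) (him : θ.im < 0) :
    0 ≤ ((θ - c) * Complex.exp ((ψ : ℝ) * Complex.I)).re := by
  rw [re_mul_exp_mul_I]
  have h1 : (θ - c).arg < 0 := Complex.arg_neg_iff.2 (by simpa using him)
  have h2 := (abs_le.1 (mem_ofPred.1 h)).1
  exact mul_nonneg (norm_nonneg _) (Real.cos_nonneg_of_mem_Icc ⟨by linarith, by linarith⟩)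

theorem re_sub_mul_exp_pos {γ c ω : ℝ} (hc : γ < c) (hω : |ω| < Real.pi / 2) :
    0 < (((c : ℂ) - γ) * Complex.exp (ω * Complex.I)).re := by
  rw [← Complex.ofReal_sub, Complex.re_ofReal_mul, Complex.exp_ofReal_mul_I_re]
  exact mul_pos (sub_pos.2 hc) (Real.cos_pos_of_mem_Ioo (abs_lt.1 hω))

theorem closedCone_subset_openCone {γ c ψ : ℝ} (hψ0 : 0 < ψ) (hψ1 : ψ < Real.pi / 2)
    (hc : γ < c) : closedCone c (Real.pi / 2 + ψ) ⊆ openCone γ (Real.pi / 2 + ψ) := by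
  intro θ hθ
  -- Moving the apex from `c` back to `γ` adds a positive real part in both rotated directions,
  -- because `|ψ| < π/2`.
  have hsplit : ∀ ω : ℝ, ((θ - γ) * Complex.exp (ω * Complex.I)).re =
      ((θ - c) * Complex.exp (ω * Complex.I)).re +
        (((c : ℂ) - γ) * Complex.exp (ω * Complex.I)).re := fun ω => by
    rw [← Complex.add_re]; congr 1; ring
  rcases le_or_gt 0 θ.im with him | him
  · refine mem_openCone_of_re_mul_exp_neg_pos hψ0 hψ1 ?_
    rw [hsplit]
    exact add_pos_of_nonneg_of_pos (re_mul_exp_neg_nonneg_of_mem_closedCone hψ1 hθ him)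
      (re_sub_mul_exp_pos hc (by rw [abs_neg, abs_of_pos hψ0]; exact hψ1))
  · refine mem_openCone_of_re_mul_exp_pos hψ0 hψ1 ?_
    rw [hsplit]
    exact add_pos_of_nonneg_of_pos (re_mul_exp_nonneg_of_mem_closedCone hψ1 hθ him)
      (re_sub_mul_exp_pos hc (by rw [abs_of_pos hψ0]; exact hψ1))

theorem mem_openCone_of_lt_re {γ ψ : ℝ} (hψ0 : 0 < ψ) {θ : ℂ} (h : γ < θ.re) :
    θ ∈ openCone γ (Real.pi / 2 + ψ) := by
  refine ⟨fun he => by simp [he] at h, ?_⟩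
  have : |(θ - γ).arg| < Real.pi / 2 :=
    Complex.abs_arg_lt_pi_div_two_iff.2 (Or.inl (by simpa using h))
  linarith

theorem sub_mem_slitPlane_of_mem_openCone {γ φ : ℝ} (hφ : φ ≤ Real.pi) {θ : ℂ}
    (h : θ ∈ openCone γ φ) : θ - γ ∈ Complex.slitPlane := by
  rw [Complex.mem_slitPlane_iff_arg]
  refine ⟨fun he => ?_, sub_ne_zero.2 h.1⟩
  have := h.2
  rw [he, abs_of_pos Real.pi_pos] at this
  linarith

theorem mem_slitPlane_of_mem_openCone {γ φ : ℝ} (hγ : 0 < γ) (hφ : φ ≤ Real.pi) {θ : ℂ}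
    (h : θ ∈ openCone γ φ) : θ ∈ Complex.slitPlane := by
  have := sub_mem_slitPlane_of_mem_openCone hφ h
  rw [Complex.mem_slitPlane_iff] at this ⊢
  simp only [Complex.sub_re, Complex.ofReal_re, Complex.sub_im, Complex.ofReal_im, sub_zero] at this
  exact this.imp_left fun h => by linarith

theorem isOpen_openCone {γ φ : ℝ} (hφ : φ ≤ Real.pi) : IsOpen (openCone γ φ) := by
  have h1 : openCone γ φ = (fun θ : ℂ => θ - γ) ⁻¹' (Complex.slitPlane ∩ {z | |z.arg| < φ}) := by
    ext θ
    refine ⟨fun h => ⟨sub_mem_slitPlane_of_mem_openCone hφ h, h.2⟩, fun h => ⟨?_, h.2⟩⟩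
    exact sub_ne_zero.1 (Complex.slitPlane_ne_zero h.1)
  rw [h1]
  refine IsOpen.preimage (by fun_prop) ?_
  exact ContinuousOn.isOpen_inter_preimage
    (fun z hz => (Complex.continuousAt_arg hz).abs.continuousWithinAt) Complex.isOpen_slitPlane
    isOpen_Iio

/-! ### Gluing the two rotated transforms -/

/-- The continuation of the Laplace transform of `g` across the boundary of its half-plane of
convergence, obtained by rotating the path of integration. -/
noncomputable def continuedLaplace (g : ℂ → ℂ) (ψ : ℝ) (θ : ℂ) : ℂ :=
  if 0 ≤ θ.im then rayLaplace g (-ψ) θ else rayLaplace g ψ θ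

section Continuation

variable {g : ℂ → ℂ} {ψ β γ M : ℝ}

/-- To the right of `γ` the unrotated ray also converges, so each branch can be rotated back to it.
Thus the case distinction at the real axis creates no jump. -/
theorem continuedLaplace_eq_of_lt_re (hψ0 : 0 < ψ) (hψ1 : ψ < Real.pi / 2) (hβ : -1 < β)
    (hgd : ∀ z ∈ sectorW ψ, DifferentiableAt ℂ g z)
    (hgb : ∀ z ∈ sectorW ψ, ‖g z‖ ≤ M * (1 + ‖z‖ ^ β) * Real.exp (γ * z.re))
    {θ : ℂ} (hθ : γ < θ.re) : continuedLaplace g ψ θ = rayLaplace g 0 θ := by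
  have h0 : 0 < ((θ - γ) * Complex.exp ((0 : ℝ) * Complex.I)).re := by simpa using hθ
  have hm := mem_openCone_of_lt_re hψ0 hθ
  unfold continuedLaplace
  split_ifs with him
  · exact rayLaplace_eq_rayLaplace hψ1 hβ hgd hgb le_rfl (by linarith) hψ0.le
      (re_mul_exp_neg_pos_of_mem_openCone hψ1 hm him) h0
  · exact (rayLaplace_eq_rayLaplace hψ1 hβ hgd hgb (by linarith) hψ0.le le_rfl h0
      (re_mul_exp_pos_of_mem_openCone hψ1 hm (not_le.1 him))).symm

theorem differentiableAt_continuedLaplace (hψ0 : 0 < ψ) (hψ1 : ψ < Real.pi / 2) (hβ : -1 < β)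
    (hgd : ∀ z ∈ sectorW ψ, DifferentiableAt ℂ g z)
    (hgb : ∀ z ∈ sectorW ψ, ‖g z‖ ≤ M * (1 + ‖z‖ ^ β) * Real.exp (γ * z.re))
    {θ : ℂ} (hθ : θ ∈ openCone γ (Real.pi / 2 + ψ)) :
    DifferentiableAt ℂ (continuedLaplace g ψ) θ := by
  have hψπ : ψ < Real.pi := by linarith [Real.pi_pos]
  rcases lt_trichotomy θ.im 0 with him | him | him
  · refine (differentiableAt_rayLaplace hψπ hβ hgd hgb (ω := ψ) (abs_of_pos hψ0).le
      (re_mul_exp_pos_of_mem_openCone hψ1 hθ him)).congr_of_eventuallyEq ?_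
    filter_upwards [(isOpen_lt Complex.continuous_im continuous_const).mem_nhds him] with z hz
    exact if_neg (not_le.2 hz)
  · have hre : γ < θ.re := by
      have h1 := sub_mem_slitPlane_of_mem_openCone (by linarith) hθ
      rw [Complex.mem_slitPlane_iff] at h1
      simpa [him] using h1
    refine (differentiableAt_rayLaplace hψπ hβ hgd hgb (ω := 0) (by simpa using hψ0.le)
      (by simpa using hre)).congr_of_eventuallyEq ?_
    filter_upwards [(isOpen_lt continuous_const Complex.continuous_re).mem_nhds hre] with z hz
    exact continuedLaplace_eq_of_lt_re hψ0 hψ1 hβ hgd hgb hz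
  · refine (differentiableAt_rayLaplace hψπ hβ hgd hgb (ω := -ψ) (by
      rw [abs_neg, abs_of_pos hψ0])
      (re_mul_exp_neg_pos_of_mem_openCone hψ1 hθ him.le)).congr_of_eventuallyEq ?_
    filter_upwards [(isOpen_lt continuous_const Complex.continuous_im).mem_nhds him] with z hz
    exact if_pos (le_of_lt hz)

theorem tendsto_continuedLaplace (hψ0 : 0 < ψ) (hψ1 : ψ < Real.pi / 2) (hβ : -1 < β)
    (hgd : ∀ z ∈ sectorW ψ, DifferentiableAt ℂ g z)
    (hgb : ∀ z ∈ sectorW ψ, ‖g z‖ ≤ M * (1 + ‖z‖ ^ β) * Real.exp (γ * z.re))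
    {c : ℝ} (hc : γ < c) :
    Tendsto (continuedLaplace g ψ)
      (Bornology.cobounded ℂ ⊓ 𝓟 (closedCone c (Real.pi / 2 + ψ))) (𝓝 0) := by
  have hψπ : ψ < Real.pi := by linarith [Real.pi_pos]
  have h1 := tendsto_rayLaplace hψπ hβ hgd hgb (ω := -ψ) (by rw [abs_neg, abs_of_pos hψ0])
    (re_sub_mul_exp_pos hc (by rw [abs_neg, abs_of_pos hψ0]; exact hψ1))
  have h2 := tendsto_rayLaplace hψπ hβ hgd hgb (ω := ψ) (abs_of_pos hψ0).le
    (re_sub_mul_exp_pos hc (by rw [abs_of_pos hψ0]; exact hψ1))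
  refine Tendsto.if ?_ ?_
  · refine h1.mono_left (le_of_eq_of_le (inf_assoc _ _ _) (inf_le_inf_left _ ?_))
    rw [inf_principal, principal_mono]
    exact fun θ hθ => re_mul_exp_neg_nonneg_of_mem_closedCone hψ1 hθ.1 hθ.2
  · refine h2.mono_left (le_of_eq_of_le (inf_assoc _ _ _) (inf_le_inf_left _ ?_))
    rw [inf_principal, principal_mono]
    exact fun θ hθ => re_mul_exp_nonneg_of_mem_closedCone hψ1 hθ.1 (not_le.1 hθ.2)

theorem exists_norm_continuedLaplace_le (hψ0 : 0 < ψ) (hψ1 : ψ < Real.pi / 2) (hβ : -1 < β)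
    (hgd : ∀ z ∈ sectorW ψ, DifferentiableAt ℂ g z)
    (hgb : ∀ z ∈ sectorW ψ, ‖g z‖ ≤ M * (1 + ‖z‖ ^ β) * Real.exp (γ * z.re))
    {c : ℝ} (hc : γ < c) :
    ∃ C, ∀ θ ∈ closedCone c (Real.pi / 2 + ψ), ‖continuedLaplace g ψ θ‖ ≤ C := by
  have hψπ : ψ < Real.pi := by linarith [Real.pi_pos]
  obtain ⟨C₁, h1⟩ := exists_norm_rayLaplace_le hψπ hβ hgd hgb (ω := -ψ)
    (by rw [abs_neg, abs_of_pos hψ0])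
    (re_sub_mul_exp_pos hc (by rw [abs_neg, abs_of_pos hψ0]; exact hψ1))
  obtain ⟨C₂, h2⟩ := exists_norm_rayLaplace_le hψπ hβ hgd hgb (ω := ψ) (abs_of_pos hψ0).le
    (re_sub_mul_exp_pos hc (by rw [abs_of_pos hψ0]; exact hψ1))
  refine ⟨max C₁ C₂, fun θ hθ => ?_⟩
  unfold continuedLaplace
  split_ifs with him
  · exact (h1 θ (re_mul_exp_neg_nonneg_of_mem_closedCone hψ1 hθ him)).trans (le_max_left _ _)
  · exact (h2 θ (re_mul_exp_nonneg_of_mem_closedCone hψ1 hθ (not_le.1 him))).trans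
      (le_max_right _ _)

end Continuation

/-! ### The cumulant of the stable density -/

/-- Both sides are analytic in the right half-plane and agree for real `θ > 0`, so the identity
theorem applies. -/
theorem integral_rpow_mul_cexp_neg_mul_Ioi {s : ℝ} (hs : 0 < s) {θ : ℂ} (hθ : 0 < θ.re) :
    ∫ x in Ioi (0 : ℝ), ((x ^ (s - 1) : ℝ) : ℂ) * Complex.exp (-(θ * x)) =
      Real.Gamma s * θ ^ (-s : ℂ) := by
  have hopen : IsOpen {z : ℂ | 0 < z.re} := isOpen_lt continuous_const Complex.continuous_re
  have h1 : AnalyticOnNhd ℂ (fun θ : ℂ => ∫ x in Ioi (0 : ℝ),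
      ((x ^ (s - 1) : ℝ) : ℂ) * Complex.exp (-(θ * x))) {z : ℂ | 0 < z.re} := by
    refine DifferentiableOn.analyticOnNhd (fun z hz => ?_) hopen
    refine (differentiableAt_laplace ?_ (fun δ hδ => ?_) hz).differentiableWithinAt
    · exact Measurable.aestronglyMeasurable (by fun_prop)
    · refine (integrableOn_rpow_mul_exp_neg_mul_rpow (p := 1) (s := s - 1) (by linarith) one_pos
        hδ).congr_fun (fun x hx => ?_) measurableSet_Ioi
      simp only [Real.rpow_one, Complex.norm_real, Real.norm_of_nonneg
        (Real.rpow_nonneg (le_of_lt hx) (s - 1))]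
  have h2 : AnalyticOnNhd ℂ (fun θ : ℂ => (Real.Gamma s : ℂ) * θ ^ (-s : ℂ))
      {z : ℂ | 0 < z.re} := by
    refine DifferentiableOn.analyticOnNhd (fun z hz => ?_) hopen
    have : z ∈ Complex.slitPlane := Or.inl hz
    exact ((differentiableAt_id.cpow_const this).const_mul _).differentiableWithinAt
  refine h1.eqOn_of_preconnected_of_frequently_eq h2
    (convex_halfSpace_re_gt 0).isPreconnected (z₀ := 1) (by simp) ?_ hθ
  have hreal : ∀ r : ℝ, 0 < r → ∫ x in Ioi (0 : ℝ), ((x ^ (s - 1) : ℝ) : ℂ) *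
      Complex.exp (-((r : ℂ) * x)) = Real.Gamma s * (r : ℂ) ^ (-s : ℂ) := by
    intro r hr
    have := Real.integral_rpow_mul_exp_neg_mul_Ioi hs hr
    rw [← Complex.ofReal_neg, ← Complex.ofReal_cpow hr.le, ← Complex.ofReal_mul,
      Real.rpow_neg hr.le, mul_comm (Real.Gamma s), ← Real.inv_rpow hr.le, ← one_div, ← this,
      ← integral_complex_ofReal]
    congr 1 with x
    push_cast
    rfl
  -- The identity theorem only needs agreement at points accumulating at `1` and different from it;
  -- the real sequence `1 + 1/(n+1)` supplies them.
  have ht : Tendsto (fun n : ℕ => ((1 + 1 / ((n : ℝ) + 1) : ℝ) : ℂ)) atTop (𝓝[≠] 1) := by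
    refine tendsto_nhdsWithin_iff.2 ⟨?_, Eventually.of_forall fun n => ?_⟩
    · have h3 := (tendsto_one_div_add_atTop_nhds_zero_nat (𝕜 := ℝ)).const_add 1
      rw [add_zero] at h3
      exact (Complex.continuous_ofReal.tendsto 1).comp h3
    · have : (0 : ℝ) < 1 / ((n : ℝ) + 1) := by positivity
      rw [mem_compl_singleton_iff]
      exact_mod_cast (show (1 + 1 / ((n : ℝ) + 1) : ℝ) ≠ 1 by linarith)
  exact ht.frequently (Frequently.of_forall fun n => hreal _ (by positivity))

theorem norm_cexp_sub_one_le_min {θ : ℂ} (hθ : 0 ≤ θ.re) {x : ℝ} (hx : 0 < x) :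
    ‖Complex.exp (-θ * x) - 1‖ ≤ (2 + 2 * ‖θ‖) * min 1 x := by
  have hn : ‖-θ * (x : ℂ)‖ = ‖θ‖ * x := by
    rw [norm_mul, norm_neg, Complex.norm_real, Real.norm_of_nonneg hx.le]
  have h2 : ‖Complex.exp (-θ * x) - 1‖ ≤ 2 := by
    refine (norm_sub_le _ _).trans ?_
    rw [norm_one, Complex.norm_exp]
    have : Real.exp (-θ * (x : ℂ)).re ≤ 1 := Real.exp_le_one_iff.2 (by
      rw [Complex.re_mul_ofReal, Complex.neg_re]; nlinarith)
    linarith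
  have hθn := norm_nonneg θ
  rcases min_cases 1 x with ⟨h, _⟩ | ⟨h, hx1⟩
  · rw [h]; linarith
  · rw [h]
    rcases le_or_gt (‖θ‖ * x) 1 with h1 | h1
    · have := Complex.norm_exp_sub_one_le (x := -θ * x) (by rw [hn]; exact h1)
      rw [hn] at this
      nlinarith
    · nlinarith

theorem integrableOn_cexp_sub_one_mul {v : ℝ → ℝ}
    (hm : AEStronglyMeasurable v (volume.restrict (Ioi 0)))
    (hv : IntegrableOn (fun x => min 1 x * v x) (Ioi 0)) {θ : ℂ} (hθ : 0 ≤ θ.re) :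
    IntegrableOn (fun x : ℝ => (Complex.exp (-θ * x) - 1) * (v x : ℂ)) (Ioi 0) := by
  refine (hv.norm.const_mul (2 + 2 * ‖θ‖)).mono' ?_ ?_
  · exact AEStronglyMeasurable.mul (by fun_prop)
      (Complex.continuous_ofReal.comp_aestronglyMeasurable hm)
  · refine (ae_restrict_iff' measurableSet_Ioi).2 (Eventually.of_forall fun x hx => ?_)
    have hx0 : 0 < x := hx
    rw [norm_mul, Complex.norm_real, norm_mul, Real.norm_of_nonneg (lt_min one_pos hx0).le,
      ← mul_assoc]
    exact mul_le_mul_of_nonneg_right (norm_cexp_sub_one_le_min hθ hx0) (norm_nonneg _)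

theorem integrableOn_min_mul_rpow {α : ℝ} (hα0 : 0 < α) (hα1 : α < 1) :
    IntegrableOn (fun x : ℝ => min 1 x * x ^ (-1 - α)) (Ioi 0) := by
  rw [← Ioc_union_Ioi_eq_Ioi zero_le_one]
  refine IntegrableOn.union ?_ ?_
  · have h1 : IntegrableOn (fun x : ℝ => x ^ (-α)) (Ioc 0 1) :=
      (intervalIntegrable_iff_integrableOn_Ioc_of_le zero_le_one).1
        (intervalIntegral.intervalIntegrable_rpow' (by linarith))
    refine h1.congr_fun (fun x hx => ?_) measurableSet_Ioc
    simp only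
    rw [min_eq_right hx.2, show -α = 1 + (-1 - α) by ring, Real.rpow_add hx.1, Real.rpow_one]
  · refine (integrableOn_Ioi_rpow_of_lt (a := -1 - α) (by linarith) one_pos).congr_fun
      (fun x hx => ?_) measurableSet_Ioi
    simp only
    rw [min_eq_left (le_of_lt hx), one_mul]

/-- The cumulant function of the stable Lévy density `x ^ (-1 - α)`. -/
theorem integral_cexp_sub_one_mul_rpow {α : ℝ} (hα0 : 0 < α) (hα1 : α < 1) {θ : ℂ}
    (hθ : 0 < θ.re) :
    ∫ x in Ioi (0 : ℝ), (Complex.exp (-θ * x) - 1) * ((x ^ (-1 - α) : ℝ) : ℂ) =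
      Real.Gamma (-α) * θ ^ (α : ℂ) := by
  -- Integration by parts: `F` vanishes at `0` because `α < 1` and at infinity because `α > 0`.
  -- Integrating its derivative therefore relates the sought integral to the Gamma integral with
  -- exponent `1 - α`.
  set F : ℝ → ℂ := fun x => (Complex.exp (-θ * x) - 1) * ((x ^ (-α) : ℝ) : ℂ) with hF
  have hi1 : IntegrableOn (fun x : ℝ => (Complex.exp (-θ * x) - 1) * ((x ^ (-1 - α) : ℝ) : ℂ))
      (Ioi 0) := integrableOn_cexp_sub_one_mul (Measurable.aestronglyMeasurable (by fun_prop))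
        (integrableOn_min_mul_rpow hα0 hα1) hθ.le
  have hi2 : IntegrableOn (fun x : ℝ => ((x ^ ((1 - α) - 1) : ℝ) : ℂ) * Complex.exp (-(θ * x)))
      (Ioi 0) := by
    refine (integrableOn_rpow_mul_exp_neg_mul_rpow (p := 1) (s := (1 - α) - 1) (by linarith)
      one_pos hθ).mono' (Measurable.aestronglyMeasurable (by fun_prop)) ?_
    refine (ae_restrict_iff' measurableSet_Ioi).2 (Eventually.of_forall fun x hx => ?_)
    rw [norm_mul, Complex.norm_real, Complex.norm_exp,
      Real.norm_of_nonneg (Real.rpow_nonneg (le_of_lt hx) _), Real.rpow_one]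
    simp
  have hderiv : ∀ x ∈ Ioi (0 : ℝ), HasDerivAt F
      (-θ * (((x ^ ((1 - α) - 1) : ℝ) : ℂ) * Complex.exp (-(θ * x))) +
        (-α : ℂ) * ((Complex.exp (-θ * x) - 1) * ((x ^ (-1 - α) : ℝ) : ℂ))) x := by
    intro x hx
    have h1 : HasDerivAt (fun x : ℝ => -θ * (x : ℂ)) (-θ) x := by
      simpa using (Complex.ofRealCLM.hasDerivAt (x := x)).const_mul (-θ)
    have h2 : HasDerivAt (fun x : ℝ => ((x ^ (-α) : ℝ) : ℂ)) ((-α * x ^ (-α - 1) : ℝ) : ℂ) x :=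
      (Real.hasDerivAt_rpow_const (Or.inl (ne_of_gt hx))).ofReal_comp
    have h3 := (h1.cexp.sub_const 1).mul h2
    refine h3.congr_deriv ?_
    rw [show (1 - α) - 1 = -α by ring, show -α - 1 = -1 - α by ring, neg_mul θ (x : ℂ)]
    push_cast
    ring
  have hcont : ContinuousWithinAt F (Ici 0) 0 := by
    have hF0 : F 0 = 0 := by simp [hF]
    rw [ContinuousWithinAt, hF0]
    refine squeeze_zero_norm' (a := fun x : ℝ => (2 + 2 * ‖θ‖) * x ^ (1 - α)) ?_ ?_
    · filter_upwards [self_mem_nhdsWithin] with x hx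
      rcases eq_or_lt_of_le (mem_Ici.1 hx) with rfl | hx0
      · rw [hF0, norm_zero]; positivity
      · rw [hF, norm_mul, Complex.norm_real, Real.norm_of_nonneg (Real.rpow_nonneg hx0.le _),
          show 1 - α = 1 + -α by ring, Real.rpow_add hx0, Real.rpow_one, ← mul_assoc]
        refine mul_le_mul_of_nonneg_right ((norm_cexp_sub_one_le_min hθ.le hx0).trans ?_)
          (Real.rpow_nonneg hx0.le _)
        exact mul_le_mul_of_nonneg_left (min_le_right _ _) (by positivity)
    · have := ((Real.continuousAt_rpow_const 0 (1 - α) (Or.inr (by linarith))).tendsto).const_mul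
        (2 + 2 * ‖θ‖)
      rw [Real.zero_rpow (by linarith), mul_zero] at this
      exact this.mono_left nhdsWithin_le_nhds
  have hlim : Tendsto F atTop (𝓝 0) := by
    refine squeeze_zero_norm' (a := fun x : ℝ => (2 + 2 * ‖θ‖) * x ^ (-α)) ?_ ?_
    · filter_upwards [eventually_gt_atTop 0] with x hx
      rw [hF, norm_mul, Complex.norm_real, Real.norm_of_nonneg (Real.rpow_nonneg hx.le _)]
      refine mul_le_mul_of_nonneg_right ((norm_cexp_sub_one_le_min hθ.le hx).trans ?_)
        (Real.rpow_nonneg hx.le _)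
      exact mul_le_of_le_one_right (by positivity) (min_le_left _ _)
    · simpa using (tendsto_rpow_neg_atTop hα0).const_mul (2 + 2 * ‖θ‖)
  have hftc := integral_Ioi_of_hasDerivAt_of_tendsto hcont hderiv
    ((hi2.const_mul _).add (hi1.const_mul _)) hlim
  rw [integral_add (hi2.const_mul _) (hi1.const_mul _), integral_const_mul, integral_const_mul,
    integral_rpow_mul_cexp_neg_mul_Ioi (by linarith) hθ] at hftc
  have hG : Real.Gamma (1 - α) = -α * Real.Gamma (-α) := by
    rw [← Real.Gamma_add_one (by linarith), show 1 - α = -α + 1 by ring]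
  have hθ0 : θ ≠ 0 := fun h => by simp [h] at hθ
  have hpow : θ * θ ^ (-((1 - α : ℝ) : ℂ)) = θ ^ (α : ℂ) := by
    nth_rewrite 1 [← Complex.cpow_one θ]
    rw [← Complex.cpow_add _ _ hθ0]
    congr 1; push_cast; ring
  have hF0 : F 0 = 0 := by simp [hF]
  rw [hF0, hG] at hftc
  push_cast at hftc hpow
  have hα : (α : ℂ) ≠ 0 := by exact_mod_cast hα0.ne'
  refine mul_left_cancel₀ hα ?_
  rw [← hpow]
  linear_combination -hftc

/-! ### The remainder in the sector and the continuation of the cumulant -/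

theorem isCompact_sectorAnnulus (ψ r R : ℝ) :
    IsCompact ((fun p : ℝ × ℝ => (p.1 : ℂ) * Complex.exp (p.2 * Complex.I)) ''
      (Icc r R ×ˢ Icc (-ψ) ψ)) :=
  (isCompact_Icc.prod isCompact_Icc).image (by fun_prop)

theorem mem_slitPlane_of_mem_sectorW {ψ : ℝ} (hψ1 : ψ < Real.pi / 2) {z : ℂ} (hz : z ∈ sectorW ψ) :
    z ∈ Complex.slitPlane := Or.inl (re_pos_of_mem_sectorW hψ1 hz)

/-- The local bounds on `U` at zero and at infinity combine to one bound on the remainder of its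
leading term, valid in the whole sector. -/
theorem exists_bound_sub_cpow {a α β γ ψ : ℝ} (hα0 : 0 < α) (hγ : 0 < γ) (hψ1 : ψ < Real.pi / 2)
    {U : ℂ → ℂ} (hU : AnalyticOnNhd ℂ U (sectorW ψ))
    (hU0 : (fun z : ℂ => U z - (a : ℂ) * z ^ (-1 - (α : ℂ)))
      =O[𝓝[sectorW ψ] 0] (fun z : ℂ => ‖z‖ ^ β))
    (hU_inf : U =O[Bornology.cobounded ℂ ⊓ 𝓟 (sectorW ψ)] (fun z : ℂ => Real.exp (γ * z.re))) :
    ∃ M, ∀ z ∈ sectorW ψ, ‖U z - (a : ℂ) * z ^ (-1 - (α : ℂ))‖ ≤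
      M * (1 + ‖z‖ ^ β) * Real.exp (γ * z.re) := by
  obtain ⟨C₀, hC₀⟩ := hU0.bound
  obtain ⟨C₁, hC₁⟩ := hU_inf.bound
  obtain ⟨r, hr, hr'⟩ := Metric.mem_nhdsWithin_iff.1 hC₀
  rw [eventually_inf_principal] at hC₁
  obtain ⟨R, -, hR⟩ := (Filter.hasBasis_cobounded_norm (E := ℂ)).eventually_iff.1 hC₁
  have hcont : ContinuousOn (fun z : ℂ => U z - (a : ℂ) * z ^ (-1 - (α : ℂ))) (sectorW ψ) := by
    intro z hz
    exact ((hU z hz).continuousAt.sub (((continuousAt_id.cpow continuousAt_const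
      (mem_slitPlane_of_mem_sectorW hψ1 hz))).const_mul _)).continuousWithinAt
  obtain ⟨C₂, hC₂⟩ := (isCompact_sectorAnnulus ψ r (max R 1)).exists_bound_of_continuousOn
    (hcont.mono (by
      rintro _ ⟨p, hp, rfl⟩
      exact mul_exp_mul_I_mem_sectorW (by linarith [Real.pi_pos]) (hr.trans_le hp.1.1)
        (abs_le.2 hp.2)))
  -- The constants belong to the three regions: near zero, near infinity (where the power term is
  -- bounded by `|a|`), and the compact annulus between. Since `γ Re z > 0` in the sector, the
  -- exponential weight is at least `1` and may be inserted everywhere.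
  refine ⟨max (max |C₀| (|C₁| + |a|)) |C₂|, fun z hz => ?_⟩
  have hz0 : 0 < ‖z‖ := norm_pos_iff.2 hz.1
  have he : 1 ≤ Real.exp (γ * z.re) :=
    Real.one_le_exp (mul_pos hγ (re_pos_of_mem_sectorW hψ1 hz)).le
  have hβ : 0 ≤ ‖z‖ ^ β := Real.rpow_nonneg hz0.le _
  have hfinish : ∀ C D : ℝ, 0 ≤ C → C ≤ max (max |C₀| (|C₁| + |a|)) |C₂| →
      D ≤ C * (1 + ‖z‖ ^ β) * Real.exp (γ * z.re) →
      D ≤ max (max |C₀| (|C₁| + |a|)) |C₂| * (1 + ‖z‖ ^ β) * Real.exp (γ * z.re) := by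
    intro C D _ h2 h3
    refine h3.trans ?_
    gcongr
  rcases lt_or_ge ‖z‖ r with h | h
  · have h1 := hr' ⟨by simpa using h, hz⟩
    rw [mem_ofPred_eq, Real.norm_of_nonneg hβ] at h1
    refine hfinish |C₀| _ (abs_nonneg _) ((le_max_left _ _).trans (le_max_left _ _)) (h1.trans ?_)
    calc C₀ * ‖z‖ ^ β ≤ |C₀| * (1 + ‖z‖ ^ β) := by
          gcongr
          · exact le_abs_self _
          · linarith
      _ ≤ |C₀| * (1 + ‖z‖ ^ β) * Real.exp (γ * z.re) := le_mul_of_one_le_right (by positivity) he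
  rcases le_or_gt ‖z‖ (max R 1) with h' | h'
  · have h1 := hC₂ z ⟨(‖z‖, z.arg), ⟨⟨h, h'⟩, abs_le.1 hz.2⟩, Complex.norm_mul_exp_arg_mul_I z⟩
    refine hfinish |C₂| _ (abs_nonneg _) (le_max_right _ _) (h1.trans ?_)
    calc C₂ ≤ |C₂| * (1 + ‖z‖ ^ β) := (le_abs_self _).trans
          (le_mul_of_one_le_right (abs_nonneg _) (by linarith))
      _ ≤ |C₂| * (1 + ‖z‖ ^ β) * Real.exp (γ * z.re) := le_mul_of_one_le_right (by positivity) he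
  · have h1 := hR ((le_max_left R 1).trans h'.le) hz
    have hz1 : 1 ≤ ‖z‖ := (le_max_right R 1).trans h'.le
    rw [Real.norm_of_nonneg (Real.exp_pos _).le] at h1
    have h2 : ‖(a : ℂ) * z ^ (-1 - (α : ℂ))‖ ≤ |a| * Real.exp (γ * z.re) := by
      rw [norm_mul, Complex.norm_real, Real.norm_eq_abs,
        show (-1 - (α : ℂ)) = ((-1 - α : ℝ) : ℂ) by push_cast; ring, Complex.norm_cpow_real]
      exact mul_le_mul_of_nonneg_left
        ((Real.rpow_le_one_of_one_le_of_nonpos hz1 (by linarith)).trans he) (abs_nonneg _)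
    refine hfinish (|C₁| + |a|) _ (by positivity) ((le_max_right _ _).trans (le_max_left _ _)) ?_
    calc ‖U z - (a : ℂ) * z ^ (-1 - (α : ℂ))‖
        ≤ C₁ * Real.exp (γ * z.re) + |a| * Real.exp (γ * z.re) :=
          (norm_sub_le _ _).trans (add_le_add h1 h2)
      _ ≤ (|C₁| + |a|) * 1 * Real.exp (γ * z.re) := by
          rw [mul_one, add_mul]
          gcongr
          exact le_abs_self _
      _ ≤ (|C₁| + |a|) * (1 + ‖z‖ ^ β) * Real.exp (γ * z.re) := by
          gcongr
          linarith

/-- The analytic continuation of the cumulant function, with its behaviour at infinity. -/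
theorem exists_cumulant_continuation {a α β γ ψ : ℝ} (hα0 : 0 < α) (hα1 : α < 1)
    (hβ : -1 < β) (hγ : 0 < γ) (hψ0 : 0 < ψ) (hψ1 : ψ < Real.pi / 2)
    {u : ℝ → ℝ} (hu : IsLevyDensity u)
    {U : ℂ → ℂ} (hUu : ∀ x : ℝ, 0 < x → U (x : ℂ) = (u x : ℂ))
    (hU : AnalyticOnNhd ℂ U (sectorW ψ))
    (hU0 : (fun z : ℂ => U z - (a : ℂ) * z ^ (-1 - (α : ℂ)))
      =O[𝓝[sectorW ψ] 0] (fun z : ℂ => ‖z‖ ^ β))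
    (hU_inf : U =O[Bornology.cobounded ℂ ⊓ 𝓟 (sectorW ψ)] (fun z : ℂ => Real.exp (γ * z.re))) :
    ∃ K : ℂ → ℂ,
      AnalyticOnNhd ℂ K (openCone γ (Real.pi / 2 + ψ)) ∧
      (∀ θ : ℂ, γ < θ.re → K θ = cumulant u θ) ∧
      IntegrableOn (fun x : ℝ => u x - a * x ^ (-1 - α)) (Ioi 0) ∧
      (∀ c : ℝ, γ < c →
        Tendsto
          (fun θ : ℂ => K θ - ((a * Real.Gamma (-α) : ℝ) : ℂ) * θ ^ (α : ℂ)
            + ((∫ x in Ioi (0 : ℝ), (u x - a * x ^ (-1 - α)) : ℝ) : ℂ))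
          (Bornology.cobounded ℂ ⊓ 𝓟 (closedCone c (Real.pi / 2 + ψ))) (𝓝 0)) ∧
      (∀ c : ℝ, γ < c → ∃ C, ∀ θ ∈ closedCone c (Real.pi / 2 + ψ),
        ‖K θ - ((a * Real.Gamma (-α) : ℝ) : ℂ) * θ ^ (α : ℂ)‖ ≤ C) := by
  obtain ⟨M, hgb⟩ := exists_bound_sub_cpow hα0 hγ hψ1 hU hU0 hU_inf
  have hπ := Real.pi_pos
  have hψπ : ψ < Real.pi := by linarith
  set g : ℂ → ℂ := fun z => U z - (a : ℂ) * z ^ (-1 - (α : ℂ)) with hg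
  replace hgb : ∀ z ∈ sectorW ψ, ‖g z‖ ≤ M * (1 + ‖z‖ ^ β) * Real.exp (γ * z.re) := hgb
  have hgd : ∀ z ∈ sectorW ψ, DifferentiableAt ℂ g z := fun z hz =>
    (hU z hz).differentiableAt.sub ((differentiableAt_id.cpow_const
      (mem_slitPlane_of_mem_sectorW hψ1 hz)).const_mul _)
  have hreal : ∀ x : ℝ, 0 < x → (x : ℂ) ∈ sectorW ψ := fun x hx => by
    simpa using mul_exp_mul_I_mem_sectorW hψπ hx (ω := 0) (by simpa using hψ0.le)
  have hgx : ∀ x : ℝ, 0 < x → g x = ((u x - a * x ^ (-1 - α) : ℝ) : ℂ) := fun x hx => by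
    simp only [hg]
    rw [hUu x hx, Complex.ofReal_sub, Complex.ofReal_mul, Complex.ofReal_cpow hx.le]
    push_cast; rfl
  have hucont : ContinuousOn u (Ioi 0) := by
    have h1 : ContinuousOn (fun x : ℝ => (U x).re) (Ioi 0) := fun x hx =>
      (Complex.continuous_re.continuousAt.comp (ContinuousAt.comp (g := U)
        (hU _ (hreal x hx)).continuousAt Complex.continuous_ofReal.continuousAt)).continuousWithinAt
    exact h1.congr fun x hx => by simp [hUu x hx]
  have hum : AEStronglyMeasurable u (volume.restrict (Ioi 0)) :=
    hucont.aestronglyMeasurable measurableSet_Ioi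
  have hpm : AEStronglyMeasurable (fun x : ℝ => x ^ (-1 - α)) (volume.restrict (Ioi 0)) :=
    Measurable.aestronglyMeasurable (by fun_prop)
  have hvm : AEStronglyMeasurable (fun x : ℝ => u x - a * x ^ (-1 - α))
      (volume.restrict (Ioi 0)) := hum.sub (hpm.const_mul a)
  -- Near zero the remainder is dominated by a multiple of `1 + x^β`. Near infinity the exponential
  -- bound is useless, but `u` is integrable there by the Lévy condition, and so is `x^(-1-α)`.
  have hvi : IntegrableOn (fun x : ℝ => u x - a * x ^ (-1 - α)) (Ioi 0) := by
    rw [← Ioc_union_Ioi_eq_Ioi zero_le_one]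
    refine IntegrableOn.union ?_ ?_
    · have h1 : IntegrableOn (fun x : ℝ => x ^ β) (Ioc 0 1) :=
        (intervalIntegrable_iff_integrableOn_Ioc_of_le zero_le_one).1
          (intervalIntegral.intervalIntegrable_rpow' hβ)
      have h2 : IntegrableOn (fun _ : ℝ => (1 : ℝ)) (Ioc 0 1) := by simp
      refine ((h2.add h1).const_mul (|M| * Real.exp γ)).mono'
        (hvm.mono_measure (Measure.restrict_mono Ioc_subset_Ioi_self le_rfl)) ?_
      refine (ae_restrict_iff' measurableSet_Ioc).2 (Eventually.of_forall fun x hx => ?_)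
      have h3 := hgb x (hreal x hx.1)
      rw [hgx x hx.1, Complex.norm_real, Complex.norm_real, Real.norm_of_nonneg hx.1.le,
        Complex.ofReal_re] at h3
      have hxβ : 0 ≤ x ^ β := Real.rpow_nonneg hx.1.le _
      refine h3.trans ?_
      calc M * (1 + x ^ β) * Real.exp (γ * x) ≤ |M| * (1 + x ^ β) * Real.exp γ := by
            gcongr
            · exact le_abs_self M
            · nlinarith [hx.2]
        _ = |M| * Real.exp γ * (1 + x ^ β) := by ring
    · refine Integrable.sub ?_ ((integrableOn_Ioi_rpow_of_lt (a := -1 - α) (by linarith)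
        one_pos).const_mul a)
      refine (hu.2.mono_set (Ioi_subset_Ioi zero_le_one)).congr_fun (fun x hx => ?_)
        measurableSet_Ioi
      simp only
      rw [min_eq_left (le_of_lt hx), one_mul]
  set A : ℂ := ((a * Real.Gamma (-α) : ℝ) : ℂ) with hA
  set J : ℂ := ((∫ x in Ioi (0 : ℝ), (u x - a * x ^ (-1 - α)) : ℝ) : ℂ) with hJ
  -- The continuation is the stable cumulant, minus the total integral of the remainder, plus the
  -- continued Laplace transform of the remainder. The asymptotic statement then says exactly that
  -- the last term tends to zero.
  refine ⟨fun θ => A * θ ^ (α : ℂ) - J + continuedLaplace g ψ θ, ?_, fun θ hθ => ?_, hvi,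
    fun c hc => ?_, fun c hc => ?_⟩
  · refine DifferentiableOn.analyticOnNhd (fun θ hθ => ?_) (isOpen_openCone (by linarith))
    have hs := mem_slitPlane_of_mem_openCone hγ (by linarith) hθ
    exact (((((differentiableAt_id.cpow_const hs).const_mul A).sub_const J).add
      (differentiableAt_continuedLaplace hψ0 hψ1 hβ hgd hgb hθ))).differentiableWithinAt
  · have hθ0 : 0 < θ.re := hγ.trans hθ
    have hviC : IntegrableOn (fun x : ℝ => ((u x - a * x ^ (-1 - α) : ℝ) : ℂ)) (Ioi 0) :=
      hvi.ofReal
    have hL : IntegrableOn (fun x : ℝ => Complex.exp (-θ * x) *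
        ((u x - a * x ^ (-1 - α) : ℝ) : ℂ)) (Ioi 0) := by
      refine Integrable.mono hviC (AEStronglyMeasurable.mul (by fun_prop) hviC.1) ?_
      refine (ae_restrict_iff' measurableSet_Ioi).2 (Eventually.of_forall fun x hx => ?_)
      rw [norm_mul, Complex.norm_exp]
      refine mul_le_of_le_one_left (norm_nonneg _) (Real.exp_le_one_iff.2 ?_)
      rw [Complex.re_mul_ofReal, Complex.neg_re]
      nlinarith [mem_Ioi.1 hx]
    have hS := integrableOn_cexp_sub_one_mul hpm (integrableOn_min_mul_rpow hα0 hα1) hθ0.le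
    -- The terms `e^(-θx)` and `1` may be separated only against the integrable remainder; for the
    -- singular power they must stay together.
    have h1 : cumulant u θ = (∫ x in Ioi (0 : ℝ),
          (Complex.exp (-θ * x) * ((u x - a * x ^ (-1 - α) : ℝ) : ℂ)
            - ((u x - a * x ^ (-1 - α) : ℝ) : ℂ))) +
        ∫ x in Ioi (0 : ℝ), (a : ℂ) *
          ((Complex.exp (-θ * x) - 1) * ((x ^ (-1 - α) : ℝ) : ℂ)) := by
      have hLv : IntegrableOn (fun x : ℝ => Complex.exp (-θ * x) *
          ((u x - a * x ^ (-1 - α) : ℝ) : ℂ) - ((u x - a * x ^ (-1 - α) : ℝ) : ℂ)) (Ioi 0) :=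
        hL.sub hviC
      rw [← integral_add hLv (hS.const_mul _)]
      unfold cumulant
      congr 1 with x
      push_cast
      ring
    simp only
    rw [h1, integral_sub hL hviC, integral_const_mul, integral_cexp_sub_one_mul_rpow hα0 hα1 hθ0,
      continuedLaplace_eq_of_lt_re hψ0 hψ1 hβ hgd hgb hθ]
    have h2 : rayLaplace g 0 θ = ∫ x in Ioi (0 : ℝ), Complex.exp (-θ * x) *
        ((u x - a * x ^ (-1 - α) : ℝ) : ℂ) := by
      unfold rayLaplace
      refine setIntegral_congr_fun measurableSet_Ioi fun x hx => ?_
      simp only [Complex.ofReal_zero, zero_mul, Complex.exp_zero, mul_one]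
      rw [hgx x hx, mul_comm, neg_mul]
    rw [h2, hA, hJ, integral_complex_ofReal]
    push_cast
    ring
  · refine (tendsto_continuedLaplace hψ0 hψ1 hβ hgd hgb hc).congr fun θ => ?_
    ring
  · obtain ⟨C, hC⟩ := exists_norm_continuedLaplace_le hψ0 hψ1 hβ hgd hgb hc
    refine ⟨‖J‖ + C, fun θ hθ => ?_⟩
    have : A * θ ^ (α : ℂ) - J + continuedLaplace g ψ θ - A * θ ^ (α : ℂ) =
        -J + continuedLaplace g ψ θ := by ring
    rw [this]
    refine (norm_add_le _ _).trans ?_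
    rw [norm_neg]
    linarith [hC θ hθ]

/-! ### Growth along the contour and termwise integration -/

theorem Real.add_rpow_le_rpow_add_rpow {α x y : ℝ} (hx : 0 ≤ x) (hy : 0 ≤ y) (hα0 : 0 ≤ α)
    (hα1 : α ≤ 1) : (x + y) ^ α ≤ x ^ α + y ^ α := by
  exact_mod_cast NNReal.rpow_add_le_add_rpow ⟨x, hx⟩ ⟨y, hy⟩ hα0 hα1

theorem exists_mul_rpow_le_mul_add {α : ℝ} (hα0 : 0 < α) (hα1 : α < 1) (B : ℝ) {b : ℝ}
    (hb : 0 < b) : ∃ D, ∀ r : ℝ, 0 ≤ r → B * r ^ α ≤ b * r + D := by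
  have h1 := (tendsto_rpow_neg_atTop (sub_pos.2 hα1)).const_mul |B|
  rw [mul_zero] at h1
  -- Beyond `L` the ratio `|B| r^α / r` is below `b`, so the linear term wins; up to `L` the
  -- constant `|B| L^α` suffices.
  obtain ⟨L, hL, hL0⟩ := ((h1.eventually (gt_mem_nhds hb)).and (eventually_gt_atTop 0)).exists
  refine ⟨|B| * L ^ α, fun r hr => (mul_le_mul_of_nonneg_right (le_abs_self B)
    (Real.rpow_nonneg hr _)).trans ?_⟩
  rcases le_or_gt r L with h | h
  · have : |B| * r ^ α ≤ |B| * L ^ α := by gcongr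
    nlinarith [mul_nonneg hb.le hr]
  · have hr0 : 0 < r := hL0.trans h
    have h2 : r ^ (-(1 - α)) ≤ L ^ (-(1 - α)) :=
      Real.rpow_le_rpow_of_nonpos hL0 h.le (by linarith)
    have h3 : r ^ α = r * r ^ (-(1 - α)) := by
      rw [← Real.rpow_one_add' hr (by linarith)]; congr 1; ring
    have h4 : |B| * r ^ α ≤ b * r := by
      rw [h3]
      calc |B| * (r * r ^ (-(1 - α))) = r * (|B| * r ^ (-(1 - α))) := by ring
        _ ≤ r * (|B| * L ^ (-(1 - α))) := by gcongr
        _ ≤ r * b := by gcongr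
        _ = b * r := mul_comm _ _
    have : 0 ≤ |B| * L ^ α := by positivity
    linarith

theorem rayPoint_mem_closedCone {c φ ω r : ℝ} (hφ : φ < Real.pi) (hω : |ω| ≤ φ) (hr : 0 ≤ r) :
    rayPoint c ω r ∈ closedCone c φ := by
  unfold rayPoint closedCone
  rw [mem_ofPred_eq, add_sub_cancel_left]
  rcases hr.eq_or_lt with rfl | hr0
  · simpa using (abs_nonneg ω).trans hω
  · have := abs_le.1 hω
    rw [arg_mul_exp_mul_I hr0 ⟨by linarith, by linarith⟩]
    exact hω

theorem closedCone_subset_closedCone {c s ψ : ℝ} (hψ0 : 0 < ψ) (hψ1 : ψ < Real.pi / 2)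
    (hc : c ≤ s) : closedCone s (Real.pi / 2 + ψ) ⊆ closedCone c (Real.pi / 2 + ψ) := by
  rcases hc.eq_or_lt with rfl | h
  · exact Subset.rfl
  · exact fun θ hθ => (closedCone_subset_openCone hψ0 hψ1 h hθ).2.le

theorem norm_cexp_rayPoint_mul (s ω r x : ℝ) :
    ‖Complex.exp (rayPoint s ω r * x)‖ = Real.exp (s * x) * Real.exp (x * Real.cos ω * r) := by
  rw [Complex.norm_exp, ← Real.exp_add, rayPoint, Complex.re_mul_ofReal, Complex.add_re,
    Complex.ofReal_re, Complex.re_ofReal_mul, Complex.exp_ofReal_mul_I_re]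
  congr 1; ring

section Growth

variable {α γ ψ A : ℝ} {K : ℂ → ℂ}

/-- Cones with apex `s ≥ c` lie inside the cone with apex `c`, so one constant serves all apexes in
`[c, c']`. This uniformity is what allows the contour to be moved. -/
theorem exists_norm_rayPoint_le (hα0 : 0 < α) (hα1 : α < 1) (hψ0 : 0 < ψ)
    (hψ1 : ψ < Real.pi / 2) {c c' : ℝ} (hc : 0 < c)
    (hK : ∃ C, ∀ θ ∈ closedCone c (Real.pi / 2 + ψ), ‖K θ - (A : ℂ) * θ ^ (α : ℂ)‖ ≤ C) :
    ∃ C, 0 ≤ C ∧ ∀ s ∈ Icc c c', ∀ ω : ℝ, |ω| ≤ Real.pi / 2 + ψ → ∀ r : ℝ, 0 ≤ r →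
      ‖K (rayPoint s ω r)‖ ≤ C * (1 + r ^ α) := by
  obtain ⟨C, hC⟩ := hK
  refine ⟨|C| + |A| * |c'| ^ α + |A|, by positivity, fun s hs ω hω r hr => ?_⟩
  have hmem := closedCone_subset_closedCone hψ0 hψ1 hs.1
    (rayPoint_mem_closedCone (c := s) (by linarith [Real.pi_pos]) hω hr)
  have h1 := hC _ hmem
  have hn : ‖rayPoint s ω r‖ ≤ |c'| + r := by
    unfold rayPoint
    refine (norm_add_le _ _).trans ?_
    rw [norm_mul, Complex.norm_exp_ofReal_mul_I, Complex.norm_real, Complex.norm_real, mul_one,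
      Real.norm_of_nonneg hr, Real.norm_of_nonneg (hc.le.trans hs.1)]
    linarith [hs.2.trans (le_abs_self c')]
  have h2 : ‖(A : ℂ) * rayPoint s ω r ^ (α : ℂ)‖ ≤ |A| * (|c'| ^ α + r ^ α) := by
    rw [norm_mul, Complex.norm_real, Complex.norm_cpow_real, Real.norm_eq_abs]
    refine mul_le_mul_of_nonneg_left ?_ (abs_nonneg A)
    exact (Real.rpow_le_rpow (norm_nonneg _) hn hα0.le).trans
      (Real.add_rpow_le_rpow_add_rpow (abs_nonneg _) hr hα0.le hα1.le)
  have h3 : ‖K (rayPoint s ω r)‖ ≤ C + |A| * (|c'| ^ α + r ^ α) := by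
    have := norm_add_le (K (rayPoint s ω r) - (A : ℂ) * rayPoint s ω r ^ (α : ℂ))
      ((A : ℂ) * rayPoint s ω r ^ (α : ℂ))
    rw [sub_add_cancel] at this
    linarith
  have hr' : 0 ≤ r ^ α := Real.rpow_nonneg hr _
  have h5 : 0 ≤ |A| * |c'| ^ α := by positivity
  nlinarith [le_abs_self C, abs_nonneg C, abs_nonneg A, mul_nonneg (abs_nonneg C) hr',
    mul_nonneg h5 hr']

theorem cos_of_abs_eq {ψ ω : ℝ} (hω : |ω| = Real.pi / 2 + ψ) : Real.cos ω = -Real.sin ψ := by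
  rw [← Real.cos_abs, hω, add_comm, Real.cos_add_pi_div_two]

/-- The factor `e^{θx}` dominates `e^{B|K θ|}` along the contour, locally uniformly in the apex. -/
theorem exists_exp_norm_mul_norm_le (hα0 : 0 < α) (hα1 : α < 1) (hψ0 : 0 < ψ)
    (hψ1 : ψ < Real.pi / 2) {c c' : ℝ} (hc : 0 < c)
    (hK : ∃ C, ∀ θ ∈ closedCone c (Real.pi / 2 + ψ), ‖K θ - (A : ℂ) * θ ^ (α : ℂ)‖ ≤ C)
    {x : ℝ} (hx : 0 < x) {B : ℝ} (hB : 0 ≤ B) :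
    ∃ D b : ℝ, 0 < b ∧ ∀ s ∈ Icc c c', ∀ ω : ℝ, |ω| = Real.pi / 2 + ψ → ∀ r : ℝ, 0 ≤ r →
      Real.exp (B * ‖K (rayPoint s ω r)‖) * ‖Complex.exp (rayPoint s ω r * x)‖ ≤
        D * Real.exp (-b * r) := by
  obtain ⟨C, hC0, hC⟩ := exists_norm_rayPoint_le (c' := c') hα0 hα1 hψ0 hψ1 hc hK
  have hsin : 0 < Real.sin ψ := Real.sin_pos_of_pos_of_lt_pi hψ0 (by linarith [Real.pi_pos])
  -- On the contour `Re θ` decreases at rate `sin ψ`. Half of the resulting decay absorbs the term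
  -- of order `r^α`, the other half remains.
  have hb : 0 < x * Real.sin ψ / 2 := by positivity
  obtain ⟨D, hD⟩ := exists_mul_rpow_le_mul_add hα0 hα1 (B * C) hb
  refine ⟨Real.exp (B * C + D + c' * x), x * Real.sin ψ / 2, hb, fun s hs ω hω r hr => ?_⟩
  rw [norm_cexp_rayPoint_mul, cos_of_abs_eq hω, ← Real.exp_add, ← Real.exp_add, ← Real.exp_add]
  refine Real.exp_le_exp.2 ?_
  have h1 := mul_le_mul_of_nonneg_left (hC s hs ω hω.le r hr) hB
  have h2 := hD r hr
  have h3 : s * x ≤ c' * x := mul_le_mul_of_nonneg_right hs.2 hx.le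
  linarith

theorem continuousOn_comp_rayPoint {f : ℂ → ℂ} (hψ0 : 0 < ψ) (hψ1 : ψ < Real.pi / 2)
    (hf : ContinuousOn f (openCone γ (Real.pi / 2 + ψ))) {c ω : ℝ} (hc : γ < c)
    (hω : |ω| ≤ Real.pi / 2 + ψ) :
    ContinuousOn (fun r : ℝ => f (rayPoint c ω r)) (Ici 0) := by
  refine hf.comp (f := fun r : ℝ => rayPoint c ω r) ?_ fun r hr => ?_
  · unfold rayPoint
    fun_prop
  · exact closedCone_subset_openCone hψ0 hψ1 hc
      (rayPoint_mem_closedCone (by linarith [Real.pi_pos]) hω hr)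

/-- Admitting any `f` of size `e^(B‖K‖)` covers the powers `K^n`, the exponential `e^(tK)` and the
majorant of the exponential series at once. -/
theorem integrableOn_comp_rayPoint (hα0 : 0 < α) (hα1 : α < 1) (hγ : 0 < γ) (hψ0 : 0 < ψ)
    (hψ1 : ψ < Real.pi / 2) {c : ℝ} (hc : γ < c)
    (hK : ∃ C, ∀ θ ∈ closedCone c (Real.pi / 2 + ψ), ‖K θ - (A : ℂ) * θ ^ (α : ℂ)‖ ≤ C)
    {x : ℝ} (hx : 0 < x) {B D : ℝ} (hB : 0 ≤ B) {f : ℂ → ℂ}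
    (hf : ContinuousOn f (openCone γ (Real.pi / 2 + ψ)))
    (hfB : ∀ θ, ‖f θ‖ ≤ D * Real.exp (B * ‖K θ‖)) {ω : ℝ} (hω : |ω| = Real.pi / 2 + ψ) :
    IntegrableOn (fun r : ℝ => f (rayPoint c ω r) * Complex.exp (rayPoint c ω r * x))
      (Ioi 0) := by
  obtain ⟨D', b, hb, h⟩ := exists_exp_norm_mul_norm_le (c' := c) hα0 hα1 hψ0 hψ1 (hγ.trans hc) hK
    hx hB
  have hD : 0 ≤ D := by
    have := (norm_nonneg _).trans (hfB 0)
    by_contra hneg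
    linarith [mul_neg_of_neg_of_pos (not_le.1 hneg) (Real.exp_pos (B * ‖K 0‖))]
  refine ((exp_neg_integrableOn_Ioi 0 hb).const_mul (D * D')).mono' ?_ ?_
  · refine ContinuousOn.aestronglyMeasurable ?_ measurableSet_Ioi
    refine ((continuousOn_comp_rayPoint hψ0 hψ1 hf hc hω.le).mono Ioi_subset_Ici_self).mul ?_
    unfold rayPoint
    fun_prop
  · refine (ae_restrict_iff' measurableSet_Ioi).2 (Eventually.of_forall fun r hr => ?_)
    have h1 := h c ⟨le_rfl, le_rfl⟩ ω hω r (le_of_lt hr)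
    rw [norm_mul]
    calc _ ≤ D * Real.exp (B * ‖K (rayPoint c ω r)‖) * ‖Complex.exp (rayPoint c ω r * x)‖ := by
          gcongr
          exact hfB _
      _ = D * (Real.exp (B * ‖K (rayPoint c ω r)‖) * ‖Complex.exp (rayPoint c ω r * x)‖) := by ring
      _ ≤ D * (D' * Real.exp (-b * r)) := by gcongr
      _ = _ := by ring

theorem norm_pow_le_factorial_mul_exp (z : ℂ) (n : ℕ) :
    ‖z ^ n‖ ≤ n.factorial * Real.exp (1 * ‖z‖) := by
  have := Real.pow_div_factorial_le_exp _ (norm_nonneg z) n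
  rw [div_le_iff₀ (by positivity)] at this
  rw [norm_pow, one_mul]
  linarith

theorem norm_cexp_mul_le (t z : ℂ) : ‖Complex.exp (t * z)‖ ≤ 1 * Real.exp (‖t‖ * ‖z‖) := by
  rw [one_mul, ← norm_mul, Complex.norm_exp]
  exact Real.exp_le_exp.2 (Complex.re_le_norm _)

theorem hasSum_pow_succ_div_factorial (z : ℂ) :
    HasSum (fun n : ℕ => z ^ (n + 1) / ((n + 1).factorial : ℂ)) (Complex.exp z - 1) := by
  have h := NormedSpace.expSeries_div_hasSum_exp z
  rw [← Complex.exp_eq_exp_ℂ] at h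
  simpa using (hasSum_nat_add_iff' 1).2 h

theorem hasSum_real_pow_succ_div_factorial (x : ℝ) :
    HasSum (fun n : ℕ => x ^ (n + 1) / ((n + 1).factorial : ℝ)) (Real.exp x - 1) := by
  have h := NormedSpace.expSeries_div_hasSum_exp x
  rw [← Real.exp_eq_exp_ℝ] at h
  simpa using (hasSum_nat_add_iff' 1).2 h

/-- Termwise integration of the exponential series along one ray of the contour. -/
theorem hasSum_integral_rayPoint (hα0 : 0 < α) (hα1 : α < 1) (hγ : 0 < γ) (hψ0 : 0 < ψ)
    (hψ1 : ψ < Real.pi / 2) {c : ℝ} (hc : γ < c)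
    (hKc : ContinuousOn K (openCone γ (Real.pi / 2 + ψ)))
    (hK : ∃ C, ∀ θ ∈ closedCone c (Real.pi / 2 + ψ), ‖K θ - (A : ℂ) * θ ^ (α : ℂ)‖ ≤ C)
    {x : ℝ} (hx : 0 < x) (t e : ℂ) {ω : ℝ} (hω : |ω| = Real.pi / 2 + ψ) :
    HasSum (fun n : ℕ => (∫ r in Ioi (0 : ℝ), K (rayPoint c ω r) ^ (n + 1) *
        Complex.exp (rayPoint c ω r * x) * e) * (t ^ (n + 1) / ((n + 1).factorial : ℂ)))
      (∫ r in Ioi (0 : ℝ), (Complex.exp (t * K (rayPoint c ω r)) - 1) *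
        Complex.exp (rayPoint c ω r * x) * e) := by
  have hray : ContinuousOn (fun r : ℝ => K (rayPoint c ω r)) (Ioi 0) :=
    (continuousOn_comp_rayPoint hψ0 hψ1 hKc hc hω.le).mono Ioi_subset_Ici_self
  have hexp : ContinuousOn (fun r : ℝ => Complex.exp (rayPoint c ω r * x)) (Ioi 0) := by
    unfold rayPoint
    fun_prop
  have hsum : ∀ r : ℝ, HasSum (fun n : ℕ => (‖t‖ * ‖K (rayPoint c ω r)‖) ^ (n + 1) /
      ((n + 1).factorial : ℝ) * (‖Complex.exp (rayPoint c ω r * x)‖ * ‖e‖))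
      ((Real.exp (‖t‖ * ‖K (rayPoint c ω r)‖) - 1) *
        (‖Complex.exp (rayPoint c ω r * x)‖ * ‖e‖)) := fun r =>
    (hasSum_real_pow_succ_div_factorial _).mul_right _
  have key := hasSum_integral_of_dominated_convergence (μ := volume.restrict (Ioi (0 : ℝ)))
    (F := fun (n : ℕ) (r : ℝ) => (K (rayPoint c ω r) ^ (n + 1) *
      Complex.exp (rayPoint c ω r * x) * e) * (t ^ (n + 1) / ((n + 1).factorial : ℂ)))
    (f := fun r : ℝ => (Complex.exp (t * K (rayPoint c ω r)) - 1) *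
        Complex.exp (rayPoint c ω r * x) * e)
    (fun (n : ℕ) (r : ℝ) => (‖t‖ * ‖K (rayPoint c ω r)‖) ^ (n + 1) /
      ((n + 1).factorial : ℝ) * (‖Complex.exp (rayPoint c ω r * x)‖ * ‖e‖))
    (fun n => ((((hray.pow _).mul hexp).mul continuousOn_const).mul
      continuousOn_const).aestronglyMeasurable measurableSet_Ioi)
    (fun n => Eventually.of_forall fun r => le_of_eq ?_)
    (Eventually.of_forall fun r => (hsum r).summable) ?_
    (Eventually.of_forall fun r => ?_)
  · simpa only [integral_mul_const] using key
  · simp only [norm_mul, norm_div, norm_pow, Complex.norm_natCast]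
    ring
  -- The dominating series sums to `e^(‖t‖‖K‖) - 1` times the modulus of the remaining factors, so
  -- its integrability is the growth bound with `B = ‖t‖`.
  · simp only [fun r => (hsum r).tsum_eq]
    have h1 := (integrableOn_comp_rayPoint hα0 hα1 hγ hψ0 hψ1 hc hK hx (norm_nonneg t) (D := 2)
      (f := fun θ => ((Real.exp (‖t‖ * ‖K θ‖) - 1 : ℝ) : ℂ)) ?_ (fun θ => ?_) hω).norm.mul_const ‖e‖
    · refine h1.congr (Eventually.of_forall fun r => ?_)
      simp only [norm_mul, Complex.norm_real]
      rw [Real.norm_of_nonneg (sub_nonneg.2 (Real.one_le_exp (by positivity)))]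
      ring
    · exact Complex.continuous_ofReal.comp_continuousOn
        ((Real.continuous_exp.comp_continuousOn (continuousOn_const.mul hKc.norm)).sub
          continuousOn_const)
    · have h2 : 1 ≤ Real.exp (‖t‖ * ‖K θ‖) := Real.one_le_exp (by positivity)
      rw [Complex.norm_real, Real.norm_of_nonneg (sub_nonneg.2 h2)]
      linarith
  · have := ((hasSum_pow_succ_div_factorial (t * K (rayPoint c ω r))).mul_right
      (Complex.exp (rayPoint c ω r * x) * e))
    rw [← mul_assoc] at this
    refine this.congr_fun ?_
    intro n
    rw [mul_pow]; ring

theorem hasSum_contourCoeff (hα0 : 0 < α) (hα1 : α < 1) (hγ : 0 < γ) (hψ0 : 0 < ψ)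
    (hψ1 : ψ < Real.pi / 2) {c : ℝ} (hc : γ < c)
    (hKc : ContinuousOn K (openCone γ (Real.pi / 2 + ψ)))
    (hK : ∃ C, ∀ θ ∈ closedCone c (Real.pi / 2 + ψ), ‖K θ - (A : ℂ) * θ ^ (α : ℂ)‖ ≤ C)
    {x : ℝ} (hx : 0 < x) (t : ℂ) :
    HasSum (fun n : ℕ => contourCoeff K c (Real.pi / 2 + ψ) (n + 1) x
        * t ^ (n + 1) / ((n + 1).factorial : ℂ))
      ((2 * Real.pi * Complex.I)⁻¹ * contourIntegral c (Real.pi / 2 + ψ)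
        (fun θ => (Complex.exp (t * K θ) - 1) * Complex.exp (θ * x))) := by
  have hφ : |Real.pi / 2 + ψ| = Real.pi / 2 + ψ := abs_of_pos (by linarith [Real.pi_pos])
  have h1 := hasSum_integral_rayPoint hα0 hα1 hγ hψ0 hψ1 hc hKc hK hx t
    (Complex.exp ((Real.pi / 2 + ψ : ℝ) * Complex.I)) hφ
  have h2 := hasSum_integral_rayPoint hα0 hα1 hγ hψ0 hψ1 hc hKc hK hx t
    (Complex.exp (-(Real.pi / 2 + ψ : ℝ) * Complex.I)) ((abs_neg _).trans hφ)
  refine ((h1.sub h2).mul_left (2 * Real.pi * Complex.I)⁻¹).congr_fun ?_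
  intro n
  simp only [contourCoeff, contourIntegral]
  ring

theorem contourIntegrable_pow (hα0 : 0 < α) (hα1 : α < 1) (hγ : 0 < γ) (hψ0 : 0 < ψ)
    (hψ1 : ψ < Real.pi / 2) {c : ℝ} (hc : γ < c)
    (hKc : ContinuousOn K (openCone γ (Real.pi / 2 + ψ)))
    (hK : ∃ C, ∀ θ ∈ closedCone c (Real.pi / 2 + ψ), ‖K θ - (A : ℂ) * θ ^ (α : ℂ)‖ ≤ C)
    {x : ℝ} (hx : 0 < x) (n : ℕ) :
    ContourIntegrable c (Real.pi / 2 + ψ) (fun θ => K θ ^ n * Complex.exp (θ * x)) := by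
  have hφ : |Real.pi / 2 + ψ| = Real.pi / 2 + ψ := abs_of_pos (by linarith [Real.pi_pos])
  exact ⟨integrableOn_comp_rayPoint hα0 hα1 hγ hψ0 hψ1 hc hK hx zero_le_one
    (f := fun θ => K θ ^ n) (hKc.pow n)
    (fun θ => norm_pow_le_factorial_mul_exp (K θ) n) hφ,
    integrableOn_comp_rayPoint hα0 hα1 hγ hψ0 hψ1 hc hK hx zero_le_one
    (f := fun θ => K θ ^ n) (hKc.pow n)
    (fun θ => norm_pow_le_factorial_mul_exp (K θ) n) ((abs_neg _).trans hφ)⟩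

end Growth

/-! ### Independence of the apex, and removal of the constant term -/

/-- Cauchy's theorem for two parallel rays with real apexes `c ≤ c'`. -/
theorem integral_ray_sub_integral_parallel_ray {H : Set ℂ} (hHo : IsOpen H) (hHc : Convex ℝ H)
    {f : ℂ → ℂ} (hf : DifferentiableOn ℂ f H) {c c' ω : ℝ} (hcc : c ≤ c')
    (hray : ∀ s ∈ Icc c c', ∀ r : ℝ, 0 ≤ r → rayPoint s ω r ∈ H)
    {B : ℝ → ℝ} (hB : ∀ s ∈ Icc c c', ∀ r : ℝ, 0 ≤ r → ‖f (rayPoint s ω r)‖ ≤ B r)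
    (hB0 : Tendsto B atTop (𝓝 0))
    (hi : IntegrableOn (fun r : ℝ => f (rayPoint c ω r)) (Ioi 0))
    (hi' : IntegrableOn (fun r : ℝ => f (rayPoint c' ω r)) (Ioi 0)) :
    (∫ r in Ioi (0 : ℝ), f (rayPoint c ω r) * Complex.exp (ω * Complex.I)) -
      (∫ r in Ioi (0 : ℝ), f (rayPoint c' ω r) * Complex.exp (ω * Complex.I)) =
      ∫ s in c..c', f s := by
  -- A primitive on the convex set `H` turns every integral into a difference of end values, and
  -- only the far ends need an estimate.
  obtain ⟨F, hF⟩ := hHc.exists_forall_hasDerivWithinAt hf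
  replace hF : ∀ z ∈ H, HasDerivAt F (f z) z := fun z hz => (hF z hz).hasDerivAt (hHo.mem_nhds hz)
  have hcont : ∀ s ∈ Icc c c', ContinuousOn (fun r : ℝ => f (rayPoint s ω r)) (Ici 0) :=
    fun s hs => hf.continuousOn.comp (f := fun r : ℝ => rayPoint s ω r)
      (by unfold rayPoint; fun_prop) (fun r hr => hray s hs r hr)
  have hreal : ∀ s ∈ Icc c c', (s : ℂ) ∈ H := fun s hs => by
    simpa [rayPoint] using hray s hs 0 le_rfl
  have hftc : ∀ s ∈ Icc c c', ∀ R : ℝ, 0 ≤ R →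
      ∫ r in (0 : ℝ)..R, f (rayPoint s ω r) * Complex.exp (ω * Complex.I) =
        F (rayPoint s ω R) - F s := by
    intro s hs R hR
    have h1 : rayPoint s ω 0 = s := by simp [rayPoint]
    rw [← h1]
    refine intervalIntegral.integral_eq_sub_of_hasDerivAt (f := fun r : ℝ => F (rayPoint s ω r))
      (fun r hr => ?_) ?_
    · rw [uIcc_of_le hR] at hr
      have h2 : HasDerivAt (fun r : ℝ => rayPoint s ω r) (Complex.exp (ω * Complex.I)) r := by
        unfold rayPoint
        simpa using ((Complex.ofRealCLM.hasDerivAt (x := r)).mul_const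
          (Complex.exp (ω * Complex.I))).const_add (s : ℂ)
      exact (hF _ (hray s hs r hr.1)).comp r h2
    · refine ContinuousOn.intervalIntegrable ?_
      rw [uIcc_of_le hR]
      exact ((hcont s hs).mono Icc_subset_Ici_self).mul continuousOn_const
  have hbase : ∫ s in c..c', f s = F c' - F c := by
    refine intervalIntegral.integral_eq_sub_of_hasDerivAt (f := fun s : ℝ => F s)
      (fun s hs => ?_) ?_
    · rw [uIcc_of_le hcc] at hs
      exact (hF _ (hreal s hs)).comp_ofReal
    · refine ContinuousOn.intervalIntegrable ?_
      rw [uIcc_of_le hcc]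
      exact hf.continuousOn.comp (f := fun s : ℝ => (s : ℂ)) (by fun_prop) hreal
  have hlim : ∀ s : ℝ, IntegrableOn (fun r : ℝ => f (rayPoint s ω r)) (Ioi 0) →
      Tendsto (fun R : ℝ => ∫ r in (0 : ℝ)..R, f (rayPoint s ω r) * Complex.exp (ω * Complex.I))
        atTop (𝓝 (∫ r in Ioi (0 : ℝ), f (rayPoint s ω r) * Complex.exp (ω * Complex.I))) :=
    fun s h => intervalIntegral_tendsto_integral_Ioi 0 (h.mul_const _) tendsto_id
  have hcl : c ∈ Icc c c' := ⟨le_rfl, hcc⟩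
  have hcr : c' ∈ Icc c c' := ⟨hcc, le_rfl⟩
  have hend : Tendsto (fun R : ℝ => F (rayPoint c ω R) - F (rayPoint c' ω R)) atTop (𝓝 0) := by
    refine squeeze_zero_norm' (a := fun R => B R * (c' - c)) ?_ (by simpa using hB0.mul_const _)
    filter_upwards [eventually_ge_atTop 0] with R hR
    have h2 : ∀ s ∈ Icc c c', HasDerivWithinAt (fun s : ℝ => F (rayPoint s ω R))
        (f (rayPoint s ω R)) (Icc c c') s := by
      intro s hs
      have h3 : HasDerivAt (fun s : ℝ => rayPoint s ω R) 1 s := by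
        unfold rayPoint
        simpa using (Complex.ofRealCLM.hasDerivAt (x := s)).add_const
          ((R : ℂ) * Complex.exp (ω * Complex.I))
      have := (hF _ (hray s hs R hR)).comp s h3
      rw [mul_one] at this
      exact this.hasDerivWithinAt
    -- The far ends are joined by moving the apex at fixed `R`; the mean value inequality bounds the
    -- change of `F` by `B R (c' - c)`.
    have h3 := (convex_Icc c c').norm_image_sub_le_of_norm_hasDerivWithin_le h2
      (fun s hs => hB s hs R hR) hcr hcl
    rwa [Real.norm_eq_abs, abs_sub_comm, abs_of_nonneg (sub_nonneg.2 hcc)] at h3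
  have h5 := (hlim c hi).sub (hlim c' hi')
  have h6 : Tendsto (fun R : ℝ =>
      (∫ r in (0 : ℝ)..R, f (rayPoint c ω r) * Complex.exp (ω * Complex.I)) -
        ∫ r in (0 : ℝ)..R, f (rayPoint c' ω r) * Complex.exp (ω * Complex.I)) atTop
      (𝓝 (0 + (F c' - F c))) := by
    refine (hend.add_const (F c' - F c)).congr' ?_
    filter_upwards [eventually_ge_atTop 0] with R hR
    rw [hftc c hcl R hR, hftc c' hcr R hR]
    ring
  rw [hbase, tendsto_nhds_unique h5 h6, zero_add]

theorem isOpen_setOf_re_mul_pos (γ w : ℂ) : IsOpen {θ : ℂ | 0 < ((θ - γ) * w).re} :=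
  isOpen_lt continuous_const (by fun_prop)

theorem convex_setOf_re_mul_pos (γ w : ℂ) : Convex ℝ {θ : ℂ | 0 < ((θ - γ) * w).re} := by
  intro z hz z' hz' a b ha hb hab
  rw [mem_ofPred_eq] at hz hz' ⊢
  have h1 : (a • z + b • z' - γ) * w = (a : ℂ) * ((z - γ) * w) + (b : ℂ) * ((z' - γ) * w) := by
    have : (a : ℂ) + b = 1 := by exact_mod_cast hab
    simp only [Complex.real_smul]
    linear_combination γ * w * this
  rw [h1, Complex.add_re, Complex.re_ofReal_mul, Complex.re_ofReal_mul]
  rcases ha.eq_or_lt with rfl | ha'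
  · have : b = 1 := by linarith
    simpa [this] using hz'
  · exact add_pos_of_pos_of_nonneg (mul_pos ha' hz) (mul_nonneg hb hz'.le)

section Contour

variable {α γ ψ A : ℝ} {K : ℂ → ℂ}

theorem rayPoint_sub_mul_exp_re {γ s ω η r : ℝ} :
    ((rayPoint s ω r - γ) * Complex.exp (η * Complex.I)).re =
      (s - γ) * Real.cos η + r * Real.cos (ω + η) := by
  have : (rayPoint s ω r - γ) * Complex.exp (η * Complex.I) =
      ((s - γ : ℝ) : ℂ) * Complex.exp (η * Complex.I) +
        (r : ℂ) * Complex.exp ((ω + η : ℝ) * Complex.I) := by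
    unfold rayPoint
    push_cast
    rw [add_mul (ω : ℂ), Complex.exp_add]
    ring
  rw [this, Complex.add_re, Complex.re_ofReal_mul, Complex.re_ofReal_mul,
    Complex.exp_ofReal_mul_I_re, Complex.exp_ofReal_mul_I_re]

/-- Each half of the contour runs parallel to the boundary of one rotated half-plane with base point
`γ`, and that half-plane is convex and contained in the open cone. Both halves change by the same
integral over `[c, c']`, which cancels in their difference. -/
theorem contourIntegral_eq_of_le (hα0 : 0 < α) (hα1 : α < 1) (hγ : 0 < γ) (hψ0 : 0 < ψ)
    (hψ1 : ψ < Real.pi / 2) {c c' : ℝ} (hc : γ < c) (hcc : c ≤ c')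
    (hKd : DifferentiableOn ℂ K (openCone γ (Real.pi / 2 + ψ)))
    (hK : ∀ c : ℝ, γ < c →
      ∃ C, ∀ θ ∈ closedCone c (Real.pi / 2 + ψ), ‖K θ - (A : ℂ) * θ ^ (α : ℂ)‖ ≤ C)
    {x : ℝ} (hx : 0 < x) (n : ℕ) :
    contourIntegral c (Real.pi / 2 + ψ) (fun θ => K θ ^ n * Complex.exp (θ * x)) =
      contourIntegral c' (Real.pi / 2 + ψ) (fun θ => K θ ^ n * Complex.exp (θ * x)) := by
  have hφ : |Real.pi / 2 + ψ| = Real.pi / 2 + ψ := abs_of_pos (by linarith [Real.pi_pos])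
  obtain ⟨D, b, hb, hD⟩ := exists_exp_norm_mul_norm_le (c' := c') hα0 hα1 hψ0 hψ1 (hγ.trans hc)
    (hK c hc) hx zero_le_one
  have hB0 : Tendsto (fun r : ℝ => n.factorial * (D * Real.exp (-b * r))) atTop (𝓝 0) := by
    have h1 : Tendsto (fun r : ℝ => Real.exp (-b * r)) atTop (𝓝 0) :=
      Real.tendsto_exp_atBot.comp (tendsto_id.const_mul_atTop_of_neg (neg_lt_zero.2 hb))
    simpa using (h1.const_mul D).const_mul (n.factorial : ℝ)
  have hB : ∀ ω : ℝ, |ω| = Real.pi / 2 + ψ → ∀ s ∈ Icc c c', ∀ r : ℝ, 0 ≤ r →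
      ‖K (rayPoint s ω r) ^ n * Complex.exp (rayPoint s ω r * x)‖ ≤
        n.factorial * (D * Real.exp (-b * r)) := by
    intro ω hω s hs r hr
    rw [norm_mul]
    calc _ ≤ n.factorial * Real.exp (1 * ‖K (rayPoint s ω r)‖) *
          ‖Complex.exp (rayPoint s ω r * x)‖ :=
          mul_le_mul_of_nonneg_right (norm_pow_le_factorial_mul_exp _ n) (norm_nonneg _)
      _ ≤ _ := by
          rw [mul_assoc]
          exact mul_le_mul_of_nonneg_left (hD s hs ω hω r hr) (by positivity)
  have hi := contourIntegrable_pow hα0 hα1 hγ hψ0 hψ1 hc hKd.continuousOn (hK c hc) hx n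
  have hi' := contourIntegrable_pow hα0 hα1 hγ hψ0 hψ1 (hc.trans_le hcc) hKd.continuousOn
    (hK c' (hc.trans_le hcc)) hx n
  have hcos : 0 < Real.cos ψ := Real.cos_pos_of_mem_Ioo ⟨by linarith, hψ1⟩
  have hd : ∀ H : Set ℂ, H ⊆ openCone γ (Real.pi / 2 + ψ) →
      DifferentiableOn ℂ (fun θ => K θ ^ n * Complex.exp (θ * x)) H := fun H hH =>
    ((hKd.mono hH).fun_pow n).mul (by fun_prop)
  have h1 := integral_ray_sub_integral_parallel_ray
    (H := {θ : ℂ | 0 < ((θ - γ) * Complex.exp ((-ψ : ℝ) * Complex.I)).re})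
    (isOpen_setOf_re_mul_pos _ _) (convex_setOf_re_mul_pos _ _)
    (hd _ fun θ hθ => mem_openCone_of_re_mul_exp_neg_pos hψ0 hψ1 hθ) (ω := Real.pi / 2 + ψ) hcc
    (fun s hs r hr => by
      rw [mem_ofPred_eq, rayPoint_sub_mul_exp_re, add_neg_cancel_right, Real.cos_pi_div_two,
        Real.cos_neg, mul_zero, add_zero]
      exact mul_pos (by linarith [hs.1]) hcos)
    (hB _ hφ) hB0 hi.1 hi'.1
  have h2 := integral_ray_sub_integral_parallel_ray
    (H := {θ : ℂ | 0 < ((θ - γ) * Complex.exp ((ψ : ℝ) * Complex.I)).re})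
    (isOpen_setOf_re_mul_pos _ _) (convex_setOf_re_mul_pos _ _)
    (hd _ fun θ hθ => mem_openCone_of_re_mul_exp_pos hψ0 hψ1 hθ) (ω := -(Real.pi / 2 + ψ)) hcc
    (fun s hs r hr => by
      rw [mem_ofPred_eq, rayPoint_sub_mul_exp_re, neg_add, neg_add_cancel_right, Real.cos_neg,
        Real.cos_pi_div_two, mul_zero, add_zero]
      exact mul_pos (by linarith [hs.1]) hcos)
    (hB _ ((abs_neg _).trans hφ)) hB0 hi.2 hi'.2
  unfold contourIntegral
  rw [Complex.ofReal_neg] at h2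
  linear_combination h1 - h2

theorem contourCoeff_eq_contourCoeff (hα0 : 0 < α) (hα1 : α < 1) (hγ : 0 < γ) (hψ0 : 0 < ψ)
    (hψ1 : ψ < Real.pi / 2) {c c' : ℝ} (hc : γ < c) (hc' : γ < c')
    (hKd : DifferentiableOn ℂ K (openCone γ (Real.pi / 2 + ψ)))
    (hK : ∀ c : ℝ, γ < c →
      ∃ C, ∀ θ ∈ closedCone c (Real.pi / 2 + ψ), ‖K θ - (A : ℂ) * θ ^ (α : ℂ)‖ ≤ C)
    {x : ℝ} (hx : 0 < x) (n : ℕ) :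
    contourCoeff K c (Real.pi / 2 + ψ) n x = contourCoeff K c' (Real.pi / 2 + ψ) n x := by
  unfold contourCoeff
  rcases le_total c c' with h | h
  · rw [contourIntegral_eq_of_le hα0 hα1 hγ hψ0 hψ1 hc h hKd hK hx n]
  · rw [contourIntegral_eq_of_le hα0 hα1 hγ hψ0 hψ1 hc' h hKd hK hx n]

theorem integrableOn_cexp_rayPoint_mul {c ω x : ℝ} (hx : 0 < x) (hω : Real.cos ω < 0) :
    IntegrableOn (fun r : ℝ => Complex.exp (rayPoint c ω r * x)) (Ioi 0) := by
  have h1 : (Complex.exp (ω * Complex.I) * x).re < 0 := by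
    rw [Complex.re_mul_ofReal, Complex.exp_ofReal_mul_I_re]
    exact mul_neg_of_neg_of_pos hω hx
  refine ((integrableOn_exp_mul_complex_Ioi h1 0).const_mul (Complex.exp (c * x))).congr
    (Eventually.of_forall fun r => ?_)
  simp only [rayPoint]
  rw [← Complex.exp_add]
  congr 1; ring

theorem integral_cexp_rayPoint_mul {c ω x : ℝ} (hx : 0 < x) (hω : Real.cos ω < 0) :
    ∫ r in Ioi (0 : ℝ), Complex.exp (rayPoint c ω r * x) * Complex.exp (ω * Complex.I) =
      -Complex.exp (c * x) / x := by
  have h1 : (Complex.exp (ω * Complex.I) * x).re < 0 := by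
    rw [Complex.re_mul_ofReal, Complex.exp_ofReal_mul_I_re]
    exact mul_neg_of_neg_of_pos hω hx
  have h2 : ∀ r : ℝ, Complex.exp (rayPoint c ω r * x) * Complex.exp (ω * Complex.I) =
      (Complex.exp (c * x) * Complex.exp (ω * Complex.I)) *
        Complex.exp (Complex.exp (ω * Complex.I) * x * r) := fun r => by
    rw [mul_right_comm, ← Complex.exp_add (c * x : ℂ)]
    congr 2
    unfold rayPoint; ring
  have hx0 : (x : ℂ) ≠ 0 := by exact_mod_cast hx.ne'
  simp only [h2]
  rw [integral_const_mul, integral_exp_mul_complex_Ioi h1]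
  have := Complex.exp_ne_zero (ω * Complex.I)
  field_simp
  simp

/-- The integral of `e^(θx)` along either ray is `-e^(cx)/x`, independent of the direction, so its
contour integral is zero. This is why the series in `t` has no term with `n = 0`. -/
theorem contourIntegral_cexp_sub_one (hα0 : 0 < α) (hα1 : α < 1) (hγ : 0 < γ) (hψ0 : 0 < ψ)
    (hψ1 : ψ < Real.pi / 2) {c : ℝ} (hc : γ < c)
    (hKc : ContinuousOn K (openCone γ (Real.pi / 2 + ψ)))
    (hK : ∃ C, ∀ θ ∈ closedCone c (Real.pi / 2 + ψ), ‖K θ - (A : ℂ) * θ ^ (α : ℂ)‖ ≤ C)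
    {x : ℝ} (hx : 0 < x) (t : ℂ) :
    contourIntegral c (Real.pi / 2 + ψ)
        (fun θ => (Complex.exp (t * K θ) - 1) * Complex.exp (θ * x)) =
      contourIntegral c (Real.pi / 2 + ψ)
        (fun θ => Complex.exp (t * K θ) * Complex.exp (θ * x)) := by
  have hφ : |Real.pi / 2 + ψ| = Real.pi / 2 + ψ := abs_of_pos (by linarith [Real.pi_pos])
  have hsin : 0 < Real.sin ψ := Real.sin_pos_of_pos_of_lt_pi hψ0 (by linarith [Real.pi_pos])
  have h : ∀ ω : ℝ, |ω| = Real.pi / 2 + ψ →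
      ∫ r in Ioi (0 : ℝ), (Complex.exp (t * K (rayPoint c ω r)) - 1) *
        Complex.exp (rayPoint c ω r * x) * Complex.exp (ω * Complex.I) =
      (∫ r in Ioi (0 : ℝ), Complex.exp (t * K (rayPoint c ω r)) *
        Complex.exp (rayPoint c ω r * x) * Complex.exp (ω * Complex.I)) -
          -Complex.exp (c * x) / x := by
    intro ω hω
    have hcos : Real.cos ω < 0 := by rw [cos_of_abs_eq hω]; linarith
    rw [← integral_cexp_rayPoint_mul hx hcos, ← integral_sub]
    · congr 1 with r; ring
    · exact (integrableOn_comp_rayPoint hα0 hα1 hγ hψ0 hψ1 hc hK hx (norm_nonneg t)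
        (f := fun θ => Complex.exp (t * K θ))
        (Complex.continuous_exp.comp_continuousOn (continuousOn_const.mul hKc))
        (fun θ => norm_cexp_mul_le t (K θ)) hω).mul_const _
    · exact (integrableOn_cexp_rayPoint_mul hx hcos).mul_const _
  unfold contourIntegral
  have h2 := h (-(Real.pi / 2 + ψ)) ((abs_neg _).trans hφ)
  rw [Complex.ofReal_neg] at h2
  rw [h _ hφ, h2]
  ring

end Contour

/-! ### Opening the contour to a vertical line -/

section Bromwich

variable {α γ ψ A : ℝ} {K : ℂ → ℂ}

theorem tendsto_mul_exp_neg_mul_rpow_atTop {α b : ℝ} (hα0 : 0 < α) (hb : 0 < b) :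
    Tendsto (fun r : ℝ => r * Real.exp (-b * r ^ α)) atTop (𝓝 0) := by
  have h1 := (tendsto_rpow_mul_exp_neg_mul_atTop_nhds_zero (1 / α) b hb).comp
    (tendsto_rpow_atTop hα0)
  refine h1.congr' ?_
  filter_upwards [eventually_ge_atTop 0] with r hr
  simp only [Function.comp]
  rw [← Real.rpow_mul hr, mul_one_div_cancel hα0.ne', Real.rpow_one]

/-- In the sector between the vertical line and the contour, `e^{tK(θ) + θx}` decays like
`exp (-b |θ - c| ^ α)`. -/
theorem exists_norm_cexp_mul_cexp_le (hα0 : 0 < α) (hα1 : α < 1) (hA : A < 0) (hγ : 0 < γ)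
    (hψ0 : 0 < ψ) (hψ1 : ψ < Real.pi / 2) {c : ℝ} (hc : γ < c)
    (hK : ∃ C, ∀ θ ∈ closedCone c (Real.pi / 2 + ψ), ‖K θ - (A : ℂ) * θ ^ (α : ℂ)‖ ≤ C)
    {x : ℝ} (hx : 0 < x) {t : ℝ} (ht : 0 < t) :
    ∃ D b : ℝ, 0 < b ∧ ∀ ω : ℝ, Real.pi / 2 ≤ |ω| → |ω| ≤ Real.pi / 2 + ψ → ∀ r : ℝ, 0 ≤ r →
      ‖Complex.exp (t * K (rayPoint c ω r)) * Complex.exp (rayPoint c ω r * x)‖ ≤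
        D * Real.exp (-b * r ^ α) := by
  have hπ := Real.pi_pos
  have hc0 : 0 < c := hγ.trans hc
  obtain ⟨C₁, hC₁0, hC₁⟩ := exists_norm_rayPoint_le (c' := c) hα0 hα1 hψ0 hψ1 hc0 hK
  obtain ⟨C, hC⟩ := hK
  -- an angle beyond `π / 2` at which the leading term is still decaying
  have hδ : 0 < (Real.pi / 4) * (1 / α - 1) := by
    have : 1 < 1 / α := by rw [lt_div_iff₀ hα0]; linarith
    exact mul_pos (by linarith) (by linarith)
  -- This `δ` gives `α (π/2 + δ) ≤ (π/4)(1 + α) < π/2`. Hence `Re θ^α` stays positive of order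
  -- `|θ|^α` up to the angle `π/2 + δ`, while beyond that angle `cos ω ≤ -sin δ`.
  set δ := min ψ ((Real.pi / 4) * (1 / α - 1)) with hδdef
  have hδ0 : 0 < δ := lt_min hψ0 hδ
  have hδψ : δ ≤ ψ := min_le_left _ _
  set ω₀ := Real.pi / 2 + δ with hω₀
  have hαω : α * ω₀ < Real.pi / 2 := by
    have h1 : δ ≤ (Real.pi / 4) * (1 / α - 1) := min_le_right _ _
    have h2 : α * δ ≤ (Real.pi / 4) * (1 - α) := by
      calc α * δ ≤ α * ((Real.pi / 4) * (1 / α - 1)) := mul_le_mul_of_nonneg_left h1 hα0.le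
        _ = _ := by field_simp
    rw [hω₀, mul_add]
    nlinarith
  have hκ : 0 < Real.cos (α * ω₀) :=
    Real.cos_pos_of_mem_Ioo ⟨by have := mul_pos hα0 (by linarith : 0 < ω₀); linarith, hαω⟩
  set κ := Real.cos (α * ω₀) with hκdef
  have hsin : 0 < Real.sin δ := Real.sin_pos_of_pos_of_lt_pi hδ0 (by linarith)
  have hb : 0 < t * (-A * κ) := mul_pos ht (mul_pos (neg_pos.2 hA) hκ)
  -- Besides the growth of `K`, the linear decay of `e^(θx)` must pay for the target rate `t (-A κ)
  -- r^α`, so that both ranges of angle share the same `b`.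
  obtain ⟨D, hD⟩ := exists_mul_rpow_le_mul_add hα0 hα1 (t * C₁ + t * (-A * κ))
    (mul_pos hx hsin)
  refine ⟨max (Real.exp (t * C + t * (-A * κ) * c ^ α + c * x)) (Real.exp (t * C₁ + D + c * x)),
    t * (-A * κ), hb, fun ω hω₁ hω₂ r hr => ?_⟩
  have hcosω : Real.cos ω ≤ 0 := by
    rw [← Real.cos_abs]
    exact Real.cos_nonpos_of_pi_div_two_le_of_le hω₁ (by linarith)
  have hsplit : ‖Complex.exp (t * K (rayPoint c ω r)) * Complex.exp (rayPoint c ω r * x)‖ =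
      Real.exp (t * (K (rayPoint c ω r)).re + (c * x + x * Real.cos ω * r)) := by
    rw [norm_mul, norm_cexp_rayPoint_mul, Complex.norm_exp, Complex.re_ofReal_mul,
      Real.exp_add (t * _), Real.exp_add (c * x)]
  rw [hsplit]
  have hfinish : ∀ E : ℝ, t * (K (rayPoint c ω r)).re + (c * x + x * Real.cos ω * r) ≤
      E + -(t * (-A * κ)) * r ^ α →
      Real.exp (t * (K (rayPoint c ω r)).re + (c * x + x * Real.cos ω * r)) ≤
        Real.exp E * Real.exp (-(t * (-A * κ)) * r ^ α) := fun E h => by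
    rw [← Real.exp_add]; exact Real.exp_le_exp.2 h
  -- Close to the vertical the decay comes from `A θ^α` with `A < 0`, and `e^(θx)` is merely
  -- bounded. Farther left it comes from `e^(θx)`, and the real part of `K` is only estimated by its
  -- modulus.
  rcases le_or_gt |ω| ω₀ with h | h
  · refine (hfinish (t * C + t * (-A * κ) * c ^ α + c * x) ?_).trans
      (mul_le_mul_of_nonneg_right (le_max_left _ _) (Real.exp_pos _).le)
    set θ := rayPoint c ω r with hθ
    have hmem : θ ∈ closedCone c (Real.pi / 2 + ψ) :=
      rayPoint_mem_closedCone (by linarith) hω₂ hr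
    -- The angle `ω` is measured from `c`, whereas `θ^α` sees the angle from `0`; moving the apex
    -- left to `0` only narrows it.
    have harg : |θ.arg| < ω₀ := by
      have h1 : θ ∈ openCone 0 (Real.pi / 2 + δ) :=
        closedCone_subset_openCone hδ0 (by linarith) hc0
          (rayPoint_mem_closedCone (by linarith) h hr)
      simpa using h1.2
    have hcos : κ ≤ Real.cos (θ.arg * α) := by
      rw [← Real.cos_abs (θ.arg * α), abs_mul, abs_of_pos hα0, mul_comm]
      refine Real.cos_le_cos_of_nonneg_of_le_pi (by positivity) (by linarith) ?_
      exact mul_le_mul_of_nonneg_left harg.le hα0.le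
    have hr1 : r ^ α ≤ ‖θ‖ ^ α + c ^ α := by
      have h1 : r ≤ ‖θ‖ + c := by
        have h2 : ‖θ - c‖ = r := by
          rw [hθ, rayPoint, add_sub_cancel_left, norm_mul, Complex.norm_exp_ofReal_mul_I,
            Complex.norm_real, Real.norm_of_nonneg hr, mul_one]
        rw [← h2]
        refine (norm_sub_le _ _).trans ?_
        rw [Complex.norm_real, Real.norm_of_nonneg hc0.le]
      exact (Real.rpow_le_rpow hr h1 hα0.le).trans
        (Real.add_rpow_le_rpow_add_rpow (norm_nonneg _) hc0.le hα0.le hα1.le)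
    have hre : (K θ).re ≤ C + A * (‖θ‖ ^ α * κ) := by
      have h1 : ((A : ℂ) * θ ^ (α : ℂ)).re = A * (‖θ‖ ^ α * Real.cos (θ.arg * α)) := by
        rw [Complex.re_ofReal_mul, Complex.cpow_ofReal_re]
      have h2 := (Complex.re_le_norm _).trans (hC θ hmem)
      rw [Complex.sub_re, h1] at h2
      have h3 : ‖θ‖ ^ α * κ ≤ ‖θ‖ ^ α * Real.cos (θ.arg * α) :=
        mul_le_mul_of_nonneg_left hcos (Real.rpow_nonneg (norm_nonneg _) _)
      nlinarith
    have h4 : (K θ).re ≤ C + -A * κ * c ^ α - -A * κ * r ^ α := by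
      have := mul_le_mul_of_nonneg_left hr1 (mul_pos (neg_pos.2 hA) hκ).le
      linarith
    have h5 := mul_le_mul_of_nonneg_left h4 ht.le
    have h6 : x * Real.cos ω * r ≤ 0 :=
      mul_nonpos_of_nonpos_of_nonneg (mul_nonpos_of_nonneg_of_nonpos hx.le hcosω) hr
    linarith
  · refine (hfinish (t * C₁ + D + c * x) ?_).trans
      (mul_le_mul_of_nonneg_right (le_max_right _ _) (Real.exp_pos _).le)
    have h1 := mul_le_mul_of_nonneg_left
      ((Complex.re_le_norm _).trans (hC₁ c ⟨le_rfl, le_rfl⟩ ω hω₂ r hr)) ht.le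
    have h2 := hD r hr
    have h3 : Real.cos ω ≤ -Real.sin δ := by
      rw [← Real.cos_abs, ← Real.cos_add_pi_div_two, add_comm]
      exact Real.cos_le_cos_of_nonneg_of_le_pi (by linarith) (by linarith) h.le
    have h4 : x * Real.cos ω * r ≤ -(x * Real.sin δ * r) := by
      have := mul_le_mul_of_nonneg_right (mul_le_mul_of_nonneg_left h3 hx.le) hr
      linarith
    linarith

theorem integrableOn_cexp_mul_cexp_rayPoint {c x t ω D b : ℝ} (hα0 : 0 < α) (hψ0 : 0 < ψ)
    (hψ1 : ψ < Real.pi / 2) (hc : γ < c) (hKc : ContinuousOn K (openCone γ (Real.pi / 2 + ψ)))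
    (hb : 0 < b) (hω : |ω| ≤ Real.pi / 2 + ψ)
    (hD : ∀ r : ℝ, 0 ≤ r → ‖Complex.exp (t * K (rayPoint c ω r)) *
      Complex.exp (rayPoint c ω r * x)‖ ≤ D * Real.exp (-b * r ^ α)) :
    IntegrableOn (fun r : ℝ => Complex.exp (t * K (rayPoint c ω r)) *
      Complex.exp (rayPoint c ω r * x)) (Ioi 0) := by
  have h0 : IntegrableOn (fun r : ℝ => Real.exp (-b * r ^ α)) (Ioi 0) := by
    simpa using integrableOn_rpow_mul_exp_neg_mul_rpow (s := 0) (by norm_num) hα0 hb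
  refine (h0.const_mul D).mono' ?_ ?_
  · refine ContinuousOn.aestronglyMeasurable ?_ measurableSet_Ioi
    refine (Complex.continuous_exp.comp_continuousOn (continuousOn_const.mul
      ((continuousOn_comp_rayPoint hψ0 hψ1 hKc hc hω).mono Ioi_subset_Ici_self))).mul ?_
    unfold rayPoint
    fun_prop
  · exact (ae_restrict_iff' measurableSet_Ioi).2 (Eventually.of_forall fun r hr =>
      hD r (le_of_lt hr))

/-- Deformation of a half of the contour to a half of the vertical line. -/
theorem integral_rayPoint_eq_of_bound {c x t ω₁ ω₂ D b : ℝ} (hα0 : 0 < α) (hψ0 : 0 < ψ)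
    (hψ1 : ψ < Real.pi / 2) (hc : γ < c)
    (hKd : DifferentiableOn ℂ K (openCone γ (Real.pi / 2 + ψ))) (hb : 0 < b) (h₁₂ : ω₁ ≤ ω₂)
    (hω : ∀ ω ∈ Icc ω₁ ω₂, |ω| ≤ Real.pi / 2 + ψ)
    (hD : ∀ ω ∈ Icc ω₁ ω₂, ∀ r : ℝ, 0 ≤ r → ‖Complex.exp (t * K (rayPoint c ω r)) *
      Complex.exp (rayPoint c ω r * x)‖ ≤ D * Real.exp (-b * r ^ α)) :
    ∫ r in Ioi (0 : ℝ), Complex.exp (t * K (rayPoint c ω₁ r)) *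
        Complex.exp (rayPoint c ω₁ r * x) * Complex.exp (ω₁ * Complex.I) =
      ∫ r in Ioi (0 : ℝ), Complex.exp (t * K (rayPoint c ω₂ r)) *
        Complex.exp (rayPoint c ω₂ r * x) * Complex.exp (ω₂ * Complex.I) := by
  have hπ := Real.pi_pos
  have h₁ : ω₁ ∈ Icc ω₁ ω₂ := ⟨le_rfl, h₁₂⟩
  have h₂ : ω₂ ∈ Icc ω₁ ω₂ := ⟨h₁₂, le_rfl⟩
  refine integral_ray_eq_integral_ray
    (f := fun z => Complex.exp (t * K (c + z)) * Complex.exp ((c + z) * x))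
    h₁₂ (fun r hr ω hω' => ?_) (B := fun r => D * (r * Real.exp (-b * r ^ α)))
    (fun r hr ω hω' => ?_) ?_ ?_
    (integrableOn_cexp_mul_cexp_rayPoint hα0 hψ0 hψ1 hc hKd.continuousOn hb (hω _ h₁) (hD _ h₁))
    (integrableOn_cexp_mul_cexp_rayPoint hα0 hψ0 hψ1 hc hKd.continuousOn hb (hω _ h₂) (hD _ h₂))
  · have hmem : (c : ℂ) + r * Complex.exp (ω * Complex.I) ∈ openCone γ (Real.pi / 2 + ψ) :=
      closedCone_subset_openCone hψ0 hψ1 hc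
        (rayPoint_mem_closedCone (by linarith) (hω ω hω') hr.le)
    have h1 : DifferentiableAt ℂ K ((c : ℂ) + r * Complex.exp (ω * Complex.I)) :=
      hKd.differentiableAt ((isOpen_openCone (by linarith)).mem_nhds hmem)
    have h2 : DifferentiableAt ℂ (fun z : ℂ => K (c + z)) (r * Complex.exp (ω * Complex.I)) :=
      DifferentiableAt.comp (g := K) (f := fun z : ℂ => (c : ℂ) + z) _ h1 (by fun_prop)
    exact ((h2.const_mul _).cexp).mul (by fun_prop)
  · have := mul_le_mul_of_nonneg_left (hD ω hω' r hr.le) hr.le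
    refine this.trans (le_of_eq ?_)
    ring
  · have hcont : ContinuousAt (fun r : ℝ => D * (r * Real.exp (-b * r ^ α))) 0 := by
      have := Real.continuousAt_rpow_const 0 α (Or.inr hα0.le)
      fun_prop
    have := hcont.tendsto
    rw [zero_mul, mul_zero] at this
    exact this.mono_left nhdsWithin_le_nhds
  · simpa using (tendsto_mul_exp_neg_mul_rpow_atTop hα0 hb).const_mul D

theorem rayPoint_pi_div_two (c r : ℝ) : rayPoint c (Real.pi / 2) r = c + r * Complex.I := by
  unfold rayPoint
  push_cast
  rw [Complex.exp_pi_div_two_mul_I]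

theorem rayPoint_neg_pi_div_two (c r : ℝ) :
    rayPoint c (-(Real.pi / 2)) r = c + ((-r : ℝ) : ℂ) * Complex.I := by
  unfold rayPoint
  push_cast
  rw [← neg_div, Complex.exp_neg_pi_div_two_mul_I]
  ring

theorem integrableOn_Iic_of_comp_neg {G : ℝ → ℂ} (h : IntegrableOn (fun r => G (-r)) (Ioi 0)) :
    IntegrableOn G (Iic 0) := by
  rw [integrableOn_Iic_iff_integrableOn_Iio]
  have h1 := IntegrableOn.comp_neg_Iio (c := (0 : ℝ)) (f := fun r => G (-r)) (by rwa [neg_zero])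
  simpa only [neg_neg] using h1

theorem integral_eq_integral_Ioi_add_integral_Ioi_comp_neg {G : ℝ → ℂ}
    (h₁ : IntegrableOn G (Ioi 0)) (h₂ : IntegrableOn (fun r => G (-r)) (Ioi 0)) :
    Integrable G ∧ ∫ y, G y = (∫ r in Ioi (0 : ℝ), G r) + ∫ r in Ioi (0 : ℝ), G (-r) := by
  have h₂' := integrableOn_Iic_of_comp_neg h₂
  refine ⟨?_, ?_⟩
  · rw [← integrableOn_univ, ← Iic_union_Ioi (a := (0 : ℝ))]
    exact h₂'.union h₁
  · rw [← intervalIntegral.integral_Iic_add_Ioi h₂' h₁, integral_comp_neg_Ioi, neg_zero, add_comm]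

/-- The contour integral of `e^{tK(θ) + θx}` is the Bromwich integral along `Re θ = c`. -/
theorem integrable_and_contourIntegral_eq_integral_line (hα0 : 0 < α) (hα1 : α < 1) (hA : A < 0)
    (hγ : 0 < γ) (hψ0 : 0 < ψ) (hψ1 : ψ < Real.pi / 2) {c : ℝ} (hc : γ < c)
    (hKd : DifferentiableOn ℂ K (openCone γ (Real.pi / 2 + ψ)))
    (hK : ∃ C, ∀ θ ∈ closedCone c (Real.pi / 2 + ψ), ‖K θ - (A : ℂ) * θ ^ (α : ℂ)‖ ≤ C)
    {x : ℝ} (hx : 0 < x) {t : ℝ} (ht : 0 < t) :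
    Integrable (fun y : ℝ => Complex.exp (t * K (c + y * Complex.I)) *
      Complex.exp ((c + y * Complex.I) * x)) ∧
    contourIntegral c (Real.pi / 2 + ψ)
        (fun θ => Complex.exp (t * K θ) * Complex.exp (θ * x)) =
      Complex.I * ∫ y : ℝ, Complex.exp (t * K (c + y * Complex.I)) *
        Complex.exp ((c + y * Complex.I) * x) := by
  have hπ := Real.pi_pos
  obtain ⟨D, b, hb, hD⟩ := exists_norm_cexp_mul_cexp_le hα0 hα1 hA hγ hψ0 hψ1 hc hK hx ht
  have hup : ∀ ω ∈ Icc (Real.pi / 2) (Real.pi / 2 + ψ), |ω| = ω := fun ω hω =>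
    abs_of_pos (by linarith [hω.1])
  have hdn : ∀ ω ∈ Icc (-(Real.pi / 2 + ψ)) (-(Real.pi / 2)), |ω| = -ω := fun ω hω =>
    abs_of_neg (by linarith [hω.2])
  have h1 := integral_rayPoint_eq_of_bound hα0 hψ0 hψ1 hc hKd hb
    (show Real.pi / 2 ≤ Real.pi / 2 + ψ by linarith)
    (fun ω hω => by rw [hup ω hω]; exact hω.2)
    (fun ω hω => hD ω (by rw [hup ω hω]; exact hω.1) (by rw [hup ω hω]; exact hω.2))
  have h2 := integral_rayPoint_eq_of_bound hα0 hψ0 hψ1 hc hKd hb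
    (show -(Real.pi / 2 + ψ) ≤ -(Real.pi / 2) by linarith)
    (fun ω hω => by rw [hdn ω hω]; linarith [hω.1])
    (fun ω hω => hD ω (by rw [hdn ω hω]; linarith [hω.2]) (by rw [hdn ω hω]; linarith [hω.1]))
  have habs : |Real.pi / 2| = Real.pi / 2 := abs_of_pos (by linarith)
  have i1 := integrableOn_cexp_mul_cexp_rayPoint hα0 hψ0 hψ1 hc hKd.continuousOn hb
    (show |Real.pi / 2| ≤ Real.pi / 2 + ψ by rw [habs]; linarith)
    (hD _ habs.ge (by rw [habs]; linarith))
  have i2 := integrableOn_cexp_mul_cexp_rayPoint hα0 hψ0 hψ1 hc hKd.continuousOn hb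
    (show |-(Real.pi / 2)| ≤ Real.pi / 2 + ψ by rw [abs_neg, habs]; linarith)
    (hD _ (by rw [abs_neg, habs]) (by rw [abs_neg, habs]; linarith))
  simp only [rayPoint_pi_div_two] at i1 h1
  simp only [rayPoint_neg_pi_div_two] at i2 h2
  obtain ⟨hi, heq⟩ := integral_eq_integral_Ioi_add_integral_Ioi_comp_neg
    (G := fun y : ℝ => Complex.exp (t * K (c + y * Complex.I)) *
      Complex.exp ((c + y * Complex.I) * x)) i1 i2
  refine ⟨hi, ?_⟩
  rw [heq]
  unfold contourIntegral
  rw [Complex.ofReal_neg] at h2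
  rw [← h1, h2, integral_mul_const, integral_mul_const, Complex.ofReal_neg, Complex.ofReal_div,
    Complex.ofReal_ofNat, ← neg_div, Complex.exp_pi_div_two_mul_I,
    Complex.exp_neg_pi_div_two_mul_I]
  ring

end Bromwich

/-! ### Bromwich inversion for measures -/

section Density
open scoped FourierTransform ComplexOrder

/-- **Bromwich inversion.** A finite measure on `[0, ∞)` whose Laplace transform is integrable on
the line `Re θ = c` is concentrated on `(0, ∞)` and has a continuous density there. -/
theorem hasContinuousDensity_of_laplace (μ : Measure ℝ) [IsFiniteMeasure μ]
    (hμ : ∀ᵐ x ∂μ, 0 ≤ x) {c : ℝ} (hc : 0 ≤ c) {H : ℝ → ℂ}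
    (hH : ∀ y : ℝ, ∫ x, Complex.exp (-(c + y * Complex.I) * x) ∂μ = H y) (hi : Integrable H)
    {f : ℝ → ℂ} (hf : ∀ x : ℝ, 0 < x → f x = (2 * Real.pi : ℂ)⁻¹ *
      ∫ y : ℝ, H y * Complex.exp ((c + y * Complex.I) * x)) :
    (∀ x : ℝ, 0 < x → (f x).im = 0) ∧ HasContinuousDensity μ (fun x => (f x).re) := by
  have hπ := Real.pi_pos
  set e : ℝ → ENNReal := fun x => ENNReal.ofReal (Real.exp (-(c * x))) with he
  set e' : ℝ → ENNReal := fun x => ENNReal.ofReal (Real.exp (c * x)) with he'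
  have hem : Measurable e := by fun_prop
  have hem' : Measurable e' := by fun_prop
  have hee : e * e' = 1 := by
    funext x
    rw [Pi.mul_apply, he, he', ← ENNReal.ofReal_mul (Real.exp_pos _).le, ← Real.exp_add,
      neg_add_cancel, Real.exp_zero, ENNReal.ofReal_one, Pi.one_apply]
  -- The tilt by `e^(-cx)` turns the Laplace transform on `Re θ = c` into a characteristic function.
  -- The tilted measure remains finite because `c ≥ 0` and `μ` lives on `[0, ∞)`.
  set ν := μ.withDensity e with hν
  have hfin : IsFiniteMeasure ν := by
    refine isFiniteMeasure_withDensity_ofReal (Integrable.hasFiniteIntegral ?_)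
    refine (integrable_const (1 : ℝ)).mono' (by fun_prop) ?_
    filter_upwards [hμ] with x hx
    rw [Real.norm_of_nonneg (Real.exp_pos _).le]
    exact Real.exp_le_one_iff.2 (neg_nonpos.2 (mul_nonneg hc hx))
  have hchar : ∀ s : ℝ, charFun ν s = H (-s) := by
    intro s
    rw [← hH, charFun_apply_real, hν,
      integral_withDensity_eq_integral_toReal_smul hem (by simp [he])]
    congr 1 with x
    rw [ENNReal.toReal_ofReal (Real.exp_pos _).le, Complex.real_smul, Complex.ofReal_exp,
      ← Complex.exp_add]
    congr 1
    push_cast; ring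
  have hchar' : (fun ξ : ℝ => charFun ν (2 * Real.pi * ξ)) = fun ξ => H (-(2 * Real.pi) * ξ) := by
    funext ξ
    rw [hchar, neg_mul]
  have hint : Integrable (fun ξ : ℝ => charFun ν (2 * Real.pi * ξ)) := by
    rw [hchar']
    exact hi.comp_mul_left' (by linarith)
  obtain ⟨hpos, hνd⟩ := eq_withDensity_fourier_charFun ν hint
  have hcont := hint.continuous_fourier
  set F := 𝓕 (fun ξ : ℝ => charFun ν (2 * Real.pi * ξ)) with hF
  have hfF : ∀ x : ℝ, 0 < x → f x = (Real.exp (c * x) : ℂ) * F x := by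
    intro x hx
    have h1 : F x = ∫ ξ : ℝ, (fun y : ℝ => H y * Complex.exp (y * x * Complex.I))
        (-(2 * Real.pi) * ξ) := by
      rw [hF, hchar', Real.fourier_real_eq_integral_exp_smul]
      congr 1 with ξ
      simp only [smul_eq_mul]
      rw [mul_comm]
      congr 2
      push_cast; ring
    have h2 : |(-(2 * Real.pi))⁻¹| = (2 * Real.pi)⁻¹ := by
      rw [abs_inv, abs_neg, abs_of_pos (by linarith)]
    have h3 := Measure.integral_comp_mul_left
      (fun y : ℝ => H y * Complex.exp (y * x * Complex.I)) (-(2 * Real.pi))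
    rw [h1, h3, h2, hf x hx, Complex.real_smul, mul_left_comm]
    push_cast
    congr 1
    refine (integral_congr_ae (Eventually.of_forall fun y => ?_)).trans
      (integral_const_mul (Complex.exp (c * x)) _)
    rw [mul_left_comm, ← Complex.exp_add]
    congr 2
    ring
  have hre0 : ∀ x, 0 ≤ (F x).re := fun x => (Complex.le_def.1 (hpos x)).1
  have him0 : ∀ x, (F x).im = 0 := fun x => (Complex.le_def.1 (hpos x)).2.symm
  have hfre : ∀ x : ℝ, 0 < x → (f x).re = (F x).re * Real.exp (c * x) := fun x hx => by
    rw [hfF x hx, Complex.re_ofReal_mul, mul_comm]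
  refine ⟨fun x hx => by rw [hfF x hx, Complex.im_ofReal_mul, him0, mul_zero], ?_,
    fun x hx => (mul_nonneg (hre0 x) (Real.exp_pos _).le).trans_eq (hfre x hx).symm, ?_⟩
  · have h1 : Continuous fun x => (F x).re * Real.exp (c * x) :=
      (Complex.continuous_re.comp hcont).mul (by fun_prop)
    exact h1.continuousOn.congr fun x hx => hfre x hx
  · have hFm : Measurable fun x => ENNReal.ofReal (F x).re :=
      (Complex.continuous_re.comp hcont).measurable.ennreal_ofReal
    -- Multiplying by `e^(cx)` undoes the tilt. As a consequence `μ` is absolutely continuous, which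
    -- excludes an atom at `0` and puts all its mass on `(0, ∞)`.
    have h1 : μ = volume.withDensity ((fun x => ENNReal.ofReal (F x).re) * e') := by
      rw [withDensity_mul _ hFm hem', ← hνd, hν, ← withDensity_mul _ hem hem', hee,
        withDensity_one]
    have h2 : ∀ᵐ x ∂μ, x ∈ Ioi (0 : ℝ) := by
      have h3 : μ ≪ volume := by
        rw [h1]; exact withDensity_absolutelyContinuous _ _
      have h4 : ∀ᵐ x ∂μ, x ≠ 0 := h3.ae_le (compl_mem_ae_iff.2 (measure_singleton 0))
      filter_upwards [hμ, h4] with x hx hx0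
      exact lt_of_le_of_ne hx (Ne.symm hx0)
    rw [← Measure.restrict_eq_self_of_ae_mem h2, h1, restrict_withDensity measurableSet_Ioi]
    refine withDensity_congr_ae ?_
    refine (ae_restrict_iff' measurableSet_Ioi).2 (Eventually.of_forall fun x hx => ?_)
    simp only [Pi.mul_apply, he']
    rw [hfre x hx, ENNReal.ofReal_mul (hre0 x)]

end Density

/-! ### Analyticity in time and conclusion -/

/-- Convergence at a real `R > ‖t‖` is absolute in `ℂ` and dominates the series uniformly on the
ball of radius `R`. -/
theorem differentiable_of_hasSum_pow_succ {b : ℕ → ℂ} {q : ℂ → ℂ}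
    (h : ∀ t : ℂ, HasSum (fun n : ℕ => b n * t ^ (n + 1) / ((n + 1).factorial : ℂ)) (q t)) :
    Differentiable ℂ q := by
  intro t
  obtain ⟨R, hR⟩ := exists_gt ‖t‖
  have hR0 : 0 ≤ R := (norm_nonneg t).trans hR.le
  have h1 : DifferentiableOn ℂ
      (fun t : ℂ => ∑' n : ℕ, b n * t ^ (n + 1) / ((n + 1).factorial : ℂ)) (Metric.ball 0 R) := by
    refine Complex.differentiableOn_tsum_of_summable_norm (h R).summable.norm
      (fun n => by fun_prop) Metric.isOpen_ball fun n w hw => ?_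
    rw [mem_ball_zero_iff] at hw
    simp only [norm_div, norm_mul, norm_pow, Complex.norm_real, Real.norm_of_nonneg hR0]
    gcongr
  have h2 : q = fun t : ℂ => ∑' n : ℕ, b n * t ^ (n + 1) / ((n + 1).factorial : ℂ) :=
    funext fun t => (h t).tsum_eq.symm
  rw [h2]
  exact h1.differentiableAt (Metric.isOpen_ball.mem_nhds (by simpa using hR))

/-- This sign makes `a Γ(-α) θ^α` have negative real part near the vertical direction, which is what
makes the Bromwich integral converge. -/
theorem Real.Gamma_neg_neg_of_lt_one {α : ℝ} (hα0 : 0 < α) (hα1 : α < 1) :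
    Real.Gamma (-α) < 0 := by
  have h1 : Real.Gamma (1 - α) = -α * Real.Gamma (-α) := by
    rw [← Real.Gamma_add_one (by linarith), show 1 - α = -α + 1 by ring]
  have h2 := Real.Gamma_pos_of_pos (sub_pos.2 hα1)
  by_contra h
  nlinarith [not_lt.1 h]

theorem theorem8 (a α β γ ψ : ℝ) (ha : 0 < a) (hα0 : 0 < α) (hα1 : α < 1) (hβ : -1 < β)
    (hγ : 0 < γ) (hψ0 : 0 < ψ) (hψ1 : ψ < Real.pi / 2)
    (u : ℝ → ℝ) (hu : IsLevyDensity u)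
    (U : ℂ → ℂ) (hUu : ∀ x : ℝ, 0 < x → U (x : ℂ) = (u x : ℂ))
    (hU : AnalyticOnNhd ℂ U (sectorW ψ))
    (hU0 : (fun z : ℂ => U z - (a : ℂ) * z ^ (-1 - (α : ℂ)))
      =O[𝓝[sectorW ψ] 0] (fun z : ℂ => ‖z‖ ^ β))
    (hU_inf : U =O[Bornology.cobounded ℂ ⊓ 𝓟 (sectorW ψ)] (fun z : ℂ => Real.exp (γ * z.re))) :
    ∃ K : ℂ → ℂ,
      -- `K` is the analytic continuation of the cumulant function
      AnalyticOnNhd ℂ K (openCone γ (Real.pi / 2 + ψ)) ∧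
      (∀ θ : ℂ, γ < θ.re → K θ = cumulant u θ) ∧
      -- its behaviour at infinity
      IntegrableOn (fun x : ℝ => u x - a * x ^ (-1 - α)) (Ioi 0) ∧
      (∀ c : ℝ, γ < c →
        Tendsto
          (fun θ : ℂ => K θ - ((a * Real.Gamma (-α) : ℝ) : ℂ) * θ ^ (α : ℂ)
            + ((∫ x in Ioi (0 : ℝ), (u x - a * x ^ (-1 - α)) : ℝ) : ℂ))
          (Bornology.cobounded ℂ ⊓ 𝓟 (closedCone c (Real.pi / 2 + ψ))) (𝓝 0)) ∧
      -- the densities and their power series in time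
      ∃ p : ℝ → ℂ → ℂ,
        (∀ (Ω : Type*) [MeasurableSpace Ω] (P : Measure Ω) [IsProbabilityMeasure P]
          (X : ℝ≥0 → Ω → ℝ), IsSubordinatorWithLevyDensity X P u →
          ∀ t : ℝ≥0, 0 < t →
            (∀ x : ℝ, 0 < x → (p x ((t : ℝ) : ℂ)).im = 0) ∧
            HasContinuousDensity (P.map (X t)) (fun x => (p x ((t : ℝ) : ℂ)).re)) ∧
        ∀ x : ℝ, 0 < x →
          Differentiable ℂ (p x) ∧
          ∀ c : ℝ, γ < c →
            (∀ n : ℕ, 1 ≤ n → ContourIntegrable c (Real.pi / 2 + ψ)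
              (fun θ => K θ ^ n * Complex.exp (θ * x))) ∧
            ∀ t : ℂ, HasSum
              (fun n : ℕ => contourCoeff K c (Real.pi / 2 + ψ) (n + 1) x
                * t ^ (n + 1) / ((n + 1).factorial : ℂ))
              (p x t) := by
  have hπ := Real.pi_pos
  obtain ⟨K, hKa, hKc, hvi, hlim, hKb⟩ :=
    exists_cumulant_continuation hα0 hα1 hβ hγ hψ0 hψ1 hu hUu hU hU0 hU_inf
  have hA : a * Real.Gamma (-α) < 0 :=
    mul_neg_of_pos_of_neg ha (Real.Gamma_neg_neg_of_lt_one hα0 hα1)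
  have hKd : DifferentiableOn ℂ K (openCone γ (Real.pi / 2 + ψ)) := hKa.differentiableOn
  have hγ1 : γ < γ + 1 := by linarith
  -- The apex `γ + 1` is an arbitrary choice; the series for any other apex has the same
  -- coefficients by `contourCoeff_eq_contourCoeff`.
  set p : ℝ → ℂ → ℂ := fun x t => ∑' n : ℕ,
    contourCoeff K (γ + 1) (Real.pi / 2 + ψ) (n + 1) x * t ^ (n + 1) / ((n + 1).factorial : ℂ)
    with hp
  have hsum := fun (x : ℝ) (hx : 0 < x) (t : ℂ) => hasSum_contourCoeff hα0 hα1 hγ hψ0 hψ1 hγ1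
    hKd.continuousOn (hKb _ hγ1) hx t
  refine ⟨K, hKa, hKc, hvi, hlim, p, ?_, fun x hx => ⟨?_, fun c hc => ⟨fun n _ => ?_, fun t => ?_⟩⟩⟩
  · intro Ω _ P _ X hX t ht
    have ht' : (0 : ℝ) < t := ht
    have hXm := hX.subordinator.measurable t
    have hprob : IsProbabilityMeasure (P.map (X t)) :=
      Measure.isProbabilityMeasure_map hXm.aemeasurable
    have hnn : ∀ᵐ x ∂(P.map (X t)), 0 ≤ x := by
      refine (ae_map_iff hXm.aemeasurable measurableSet_Ici).2 ?_
      filter_upwards [hX.subordinator.zero, hX.subordinator.paths] with ω h0 hm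
      rw [← h0]
      exact hm.1 zero_le
    have hline : ∀ x : ℝ, 0 < x → _ := fun x hx => integrable_and_contourIntegral_eq_integral_line
      hα0 hα1 hA hγ hψ0 hψ1 hγ1 hKd (hKb _ hγ1) hx ht'
    refine hasContinuousDensity_of_laplace (P.map (X t)) hnn (c := γ + 1) (by linarith)
      (H := fun y : ℝ => Complex.exp (((t : ℝ) : ℂ) * K (((γ + 1 : ℝ) : ℂ) + y * Complex.I)))
      (fun y => ?_) ?_ (fun x hx => ?_)
    · rw [integral_map hXm.aemeasurable (by fun_prop), hX.laplace t _ (by simp; linarith),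
        hKc _ (by simp)]
    -- Integrability on the line is known with the factor `e^(θx)`. Taking `x = 1` and multiplying
    -- by `e^(-θ)`, which has constant modulus on the line, removes that factor.
    · have h1 := ((hline 1 one_pos).1).mul_bdd (c := Real.exp (-(γ + 1)))
        (g := fun y : ℝ => Complex.exp (-(((γ + 1 : ℝ) : ℂ) + y * Complex.I)))
        (by fun_prop) (Eventually.of_forall fun y => by simp [Complex.norm_exp])
      refine h1.congr (Eventually.of_forall fun y => ?_)
      simp only
      rw [mul_assoc, ← Complex.exp_add, Complex.ofReal_one, mul_one, add_neg_cancel,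
        Complex.exp_zero, mul_one]
    · rw [hp]
      simp only
      rw [(hsum x hx _).tsum_eq, contourIntegral_cexp_sub_one hα0 hα1 hγ hψ0 hψ1 hγ1
        hKd.continuousOn (hKb _ hγ1) hx, (hline x hx).2, ← mul_assoc]
      congr 1
      rw [mul_inv, mul_assoc, inv_mul_cancel₀ Complex.I_ne_zero, mul_one]
  · exact differentiable_of_hasSum_pow_succ fun t => (hsum x hx t).summable.hasSum
  · exact contourIntegrable_pow hα0 hα1 hγ hψ0 hψ1 hc hKd.continuousOn (hKb c hc) hx n
  · simp only [contourCoeff_eq_contourCoeff hα0 hα1 hγ hψ0 hψ1 hc hγ1 hKd hKb hx]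
    exact (hsum x hx t).summable.hasSum
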